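/- Consider the deterministic synchronous message passing model: the vertices of an $n$-vertex graph $G=(V,E)$ host processors with distinct identity numbers from $\{1,\dots,n\}$; initially a vertex knows only its identity number and the global parameters; in each round every vertex sends a message to its neighbors, receives their messages and performs arbitrary local computation; the running time is the number of rounds. The \emph{arboricity} of $G$ is at most $k$ if $E$ can be partitioned into $k$ edge-disjoint forests. An \emph{$m$-defective $k$-coloring} is a coloring with colors $\{1,\dots,k\}$ in which each vertex has at most $m$ neighbors of its own color; an \emph{$r$-arbdefective $k$-coloring} is one in which each color class induces a subgraph of arboricity at most $r$; a coloring is \emph{legal} if adjacent vertices get different colors. Fix a constant $\epsilon>0$. Let $\mathcal D$ be a distributed procedure that, given $n \ge 2$, $\Delta$ and $p\ge 1$, computes a $\lfloor\Delta/p\rfloor$-defective $O(p^2)$-coloring of any graph of maximum degree at most $\Delta$ with distinct identity numbers from $\{1,\dots,n\}$, in $O(\log n)$ rounds. Let $\mathcal L$ be a distributed procedure that, given $n \ge 2$ and $b\ge 1$, computes a legal $(\lfloor(2+\epsilon)b\rfloor+1)$-coloring of any graph of arboricity at most $b$ with distinct identity numbers from $\{1,\dots,n\}$, in $O(b\log n)$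 rounds. Such procedures $\mathcal D$ and $\mathcal L$ exist. Procedure \emph{Arbdefective-Coloring}$(G,k,t)$, for $G$ of arboricity at most $a$, works as follows. (1) Compute an $H$-partition: initially all vertices are active; in round $i=1,2,\dots$ each active vertex with at most $\lfloor(2+\epsilon)a\rfloor$ active neighbors joins the set $H_i$ and becomes inactive. (2) In parallel for all $i$, compute a $\lfloor a/t\rfloor$-defective $O(t^2)$-coloring of the induced subgraph $G(H_i)$ by $\mathcal D$ with $\Delta=\lfloor(2+\epsilon)a\rfloor$ and $p=\lceil 2+\epsilon\rceil t$. (3) Orient each edge between different $H$-sets towards the set of greater index, and each edge inside an $H$-set whose endpoints have different colors towards the endpoint of greater color; leave the other edges unoriented. (4) Each vertex waits until all its parents (the neighbors towards which its edges are oriented) have selected a color, and then selects a color from $\{1,\dots,k\}$ that is used by the minimum number of its parents. Consider the following algorithm. Invoke Arbdefective-Coloring once, with $k=t=\lceil a^{1/3}\rceil$, and let $G_i$, $1\le i\le k$, be the subgraph induced by the vertices that selected the color $i$. In parallel for all $i$, compute by $\mathcal L$, with $b=\lfloor(3+\epsilon)a^{2/3}\rfloor$, a legal coloring $\psi_i$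 of $G_i$ with colors from $\{1,\dots,\gamma\}$, where $\gamma=\lfloor(2+\epsilon)(3+\epsilon)a^{2/3}\rfloor+1$. Finally each vertex $v\in G_i$ sets $\varphi(v)=(i-1)\gamma+\psi_i(v)$. Then there is a constant $C$, depending only on $\epsilon$, $\mathcal D$ and $\mathcal L$, such that for all integers $n\ge 2$ and $a\ge 1$ the durations of steps (1) and (4) can be fixed in terms of $n$ and $a$ alone so that the total running time of the algorithm is at most $C\,a^{2/3}\log_2 n$ rounds and, for every $n$-vertex graph $G$ of arboricity at most $a$ and every assignment of distinct identity numbers from $\{1,\dots,n\}$, within these durations every vertex joins some set $H_i$ in step (1) and selects a color in step (4), the invocation of Arbdefective-Coloring produces a $\lfloor(3+\epsilon)a^{2/3}\rfloor$-arbdefective $\lceil a^{1/3}\rceil$-coloring, and $\varphi$ is a legal coloring of $G$ with colors from $\{1,\dots,Ca\}$. -/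

import Mathlib

universe u

/-! ### The synchronous message passing model -/

/-- A deterministic synchronous message passing procedure. Every vertex hosts a processor, which
initially holds only its identity number and its local input (`init`). In every round each vertex
sends a message to its neighbours (`send`; the same one to all of them), receives the messages of its
neighbours and updates its state (`recv`). After `rounds` rounds every vertex stops and reads its local
output off its state (`out`). The running time is the number `rounds` of rounds of communication. -/
structure LocalAlg (I O : Type) where
  State : Type
  Msg : Type
  rounds : ℕ
  init : ℕ → I → State
  send : State → Msg
  recv : State → Multiset Msg → State
  out : State → O

namespace LocalAlg

open Classical in
/-- The state of every vertex of `G` after a given number of rounds; `ident` are the identity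
numbers and `inp` the local inputs. -/
noncomputable def stateAt {I O : Type} (P : LocalAlg I O) {V : Type u} [Fintype V]
    (G : SimpleGraph V) (ident : V → ℕ) (inp : V → I) : ℕ → V → P.State
  | 0, v => P.init (ident v) (inp v)
  | r + 1, v => P.recv (P.stateAt G ident inp r v)
      ((Finset.univ.filter (fun u => G.Adj v u)).val.map
        (fun u => P.send (P.stateAt G ident inp r u)))

/-- The local outputs when the procedure stops. -/
noncomputable def run {I O : Type} (P : LocalAlg I O) {V : Type u} [Fintype V]
    (G : SimpleGraph V) (ident : V → ℕ) (inp : V → I) (v : V) : O :=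
  P.out (P.stateAt G ident inp P.rounds v)

/-- A final local computation, without communication. -/
def mapOut {I O O' : Type} (P : LocalAlg I O) (f : O → O') : LocalAlg I O' where
  State := P.State
  Msg := P.Msg
  rounds := P.rounds
  init := P.init
  send := P.send
  recv := P.recv
  out := fun s => f (P.out s)

/-- Sequential composition: `P` is executed for `P.rounds` rounds, then `Q` is invoked, the local
input of a vertex being its local output of `P`. A state consists of the identity number, the
number of rounds that have elapsed, and the current state of `P` or of `Q`. -/
def seq {I M O : Type} (P : LocalAlg I M) (Q : LocalAlg M O) : LocalAlg I O where
  State := ℕ × ℕ × (P.State ⊕ Q.State)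
  Msg := P.Msg ⊕ Q.Msg
  rounds := P.rounds + Q.rounds
  init := fun x i => (x, 0,
    if P.rounds = 0 then Sum.inr (Q.init x (P.out (P.init x i))) else Sum.inl (P.init x i))
  send := fun st => match st with
    | (_, _, Sum.inl s) => Sum.inl (P.send s)
    | (_, _, Sum.inr s) => Sum.inr (Q.send s)
  recv := fun st ms => match st with
    | (x, c, Sum.inl s) =>
        let s' := P.recv s (ms.filterMap Sum.getLeft?)
        (x, c + 1, if c + 1 = P.rounds then Sum.inr (Q.init x (P.out s')) else Sum.inl s')
    | (x, c, Sum.inr s) => (x, c + 1, Sum.inr (Q.recv s (ms.filterMap Sum.getRight?)))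
  out := fun st => match st with
    | (x, _, Sum.inl s) => Q.out (Q.init x (P.out s))
    | (_, _, Sum.inr s) => Q.out s

/-- Parallel execution of `P` on all the subgraphs induced by the vertices of equal label. The local
input is the label of the vertex; messages carry the label of the sender, and a vertex ignores the
messages from vertices of other labels. The output is the label together with the output of `P`. -/
def onParts {O : Type} (P : LocalAlg Unit O) : LocalAlg ℕ (ℕ × O) where
  State := ℕ × P.State
  Msg := ℕ × P.Msg
  rounds := P.rounds
  init := fun x i => (i, P.init x ())
  send := fun st => (st.1, P.send st.2)
  recv := fun st ms => (st.1, P.recv st.2 ((ms.filter (fun m => m.1 = st.1)).map Prod.snd))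
  out := fun st => (st.1, P.out st.2)

end LocalAlg

/-! ### Graph theoretic notions -/

/-- The arboricity of `G` is at most `k`: its edge set is partitioned into `k` edge disjoint
(possibly empty) forests. -/
def ArboricityAtMost {V : Type u} (G : SimpleGraph V) (k : ℕ) : Prop :=
  ∃ F : Fin k → SimpleGraph V, (∀ i, (F i).IsAcyclic) ∧
    (∀ i j, i ≠ j → Disjoint (F i) (F j)) ∧ G = ⨆ i, F i

/-- A legal coloring of `G` with colors in `{1, …, k}`. -/
def IsLegalColoring {V : Type u} (G : SimpleGraph V) (k : ℕ) (φ : V → ℕ) : Prop :=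
  (∀ v, 1 ≤ φ v ∧ φ v ≤ k) ∧ ∀ v w, G.Adj v w → φ v ≠ φ w

/-- An `m`-defective `k`-coloring of `G`. -/
def IsDefectiveColoring {V : Type u} (G : SimpleGraph V) (m k : ℕ) (φ : V → ℕ) : Prop :=
  (∀ v, 1 ≤ φ v ∧ φ v ≤ k) ∧ ∀ v, {w | G.Adj v w ∧ φ w = φ v}.ncard ≤ m

/-- An `r`-arbdefective `k`-coloring of `G`. -/
def IsArbdefectiveColoring {V : Type u} (G : SimpleGraph V) (r k : ℕ) (φ : V → ℕ) : Prop :=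
  (∀ v, 1 ≤ φ v ∧ φ v ≤ k) ∧ ∀ i : ℕ, ArboricityAtMost (G.induce {v | φ v = i}) r

/-- `ident` assigns distinct identity numbers from `{1, …, n}` to the vertices. -/
def IsIdentification {V : Type u} (n : ℕ) (ident : V → ℕ) : Prop :=
  Function.Injective ident ∧ ∀ v, 1 ≤ ident v ∧ ident v ≤ n

/-! ### The two kinds of subroutines -/

/-- `D n Δ p` computes `⌊Δ / p⌋`-defective `O(p²)`-colorings of all graphs of maximum degree at
most `Δ` with identity numbers from `{1, …, n}`, in `O(log n)` rounds. -/
def IsDefectiveColoringProcedure (D : ℕ → ℕ → ℕ → LocalAlg Unit ℕ) : Prop :=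
  ∃ c : ℕ, ∀ n Δ p : ℕ, 2 ≤ n → 1 ≤ p →
    ((D n Δ p).rounds : ℝ) ≤ c * Real.logb 2 n ∧
    ∀ (V : Type u) [Fintype V] (G : SimpleGraph V) (ident : V → ℕ), IsIdentification n ident →
      (∀ v, (G.neighborSet v).ncard ≤ Δ) →
      IsDefectiveColoring G (Δ / p) (c * p ^ 2) ((D n Δ p).run G ident fun _ => ())

/-- `L n b` computes legal `(⌊(2 + ε) b⌋ + 1)`-colorings of all graphs of arboricity at most `b`
with identity numbers from `{1, …, n}`, in `O(b log n)` rounds. -/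
def IsLegalColoringProcedure (ε : ℝ) (L : ℕ → ℕ → LocalAlg Unit ℕ) : Prop :=
  ∃ c : ℕ, ∀ n b : ℕ, 2 ≤ n → 1 ≤ b →
    ((L n b).rounds : ℝ) ≤ c * (b * Real.logb 2 n) ∧
    ∀ (V : Type u) [Fintype V] (G : SimpleGraph V) (ident : V → ℕ), IsIdentification n ident →
      ArboricityAtMost G b →
      IsLegalColoring G (⌊(2 + ε) * b⌋₊ + 1) ((L n b).run G ident fun _ => ())

/-! ### Procedure Arbdefective-Coloring -/

/-- The `H`-partition procedure with degree `A`, executed for `r` rounds. Initially all vertices are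
active. In round `i`, each active vertex with at most `A` active neighbours joins the set `H_i` and
becomes inactive. A state consists of the number of elapsed rounds and the `H`-index, which
is `0` as long as the vertex is active. -/
def hPartition (A r : ℕ) : LocalAlg Unit ℕ where
  State := ℕ × ℕ
  Msg := Bool
  rounds := r
  init := fun _ _ => (0, 0)
  send := fun st => decide (st.2 = 0)
  recv := fun st ms => (st.1 + 1, if st.2 = 0 ∧ ms.count true ≤ A then st.1 + 1 else st.2)
  out := fun st => st.2

/-- The orientation step. The local input is the pair of the `H`-index and the color in the defective
coloring. An edge is oriented towards the endpoint of greater `H`-index if the `H`-indices differ,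
towards the endpoint of greater color if the `H`-indices agree and the colors differ, and it is left
unoriented otherwise. The output of a vertex is the set of the identity numbers of its parents, i.e. of
the neighbours towards which its edges are oriented. -/
def orientEdges : LocalAlg (ℕ × ℕ) (Finset ℕ) where
  State := ℕ × (ℕ × ℕ) × Finset ℕ
  Msg := ℕ × (ℕ × ℕ)
  rounds := 1
  init := fun x l => (x, l, ∅)
  send := fun st => (st.1, st.2.1)
  recv := fun st ms => (st.1, st.2.1,
    ((ms.filter (fun m => st.2.1.1 < m.2.1 ∨ (st.2.1.1 = m.2.1 ∧ st.2.1.2 < m.2.2))).map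
      Prod.fst).toFinset)
  out := fun st => st.2.2

/-- Procedure Partial-Orientation: an `H`-partition of degree `A` (in `r` rounds), then the defective
coloring procedure `D` on all the subgraphs `G(H_i)` in parallel, then the orientation step. -/
def partialOrientation (A r : ℕ) (D : LocalAlg Unit ℕ) : LocalAlg Unit (Finset ℕ) :=
  (hPartition A r).seq (D.onParts.seq orientEdges)

/-- A color from `{1, …, k}` that occurs the minimum number of times in `cs` (for `k ≥ 1`). -/
def leastUsedColor (k : ℕ) (cs : Multiset ℕ) : ℕ :=
  ((List.range' 1 k).argmin (fun c => cs.count c)).getD 0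

/-- Procedure Simple-Arbdefective with `k` colors, executed for `s` rounds. The local input is the
set of the identity numbers of the parents. A vertex waits for all its parents to select their colors
and then selects a color from `{1, …, k}` used by the minimum number of parents. A state consists
of the identity number, the parents, and the selected color, which is `0` before the selection. -/
def simpleArbdefective (k s : ℕ) : LocalAlg (Finset ℕ) ℕ where
  State := ℕ × Finset ℕ × ℕ
  Msg := ℕ × ℕ
  rounds := s
  init := fun x S => (x, S, if S = ∅ then leastUsedColor k 0 else 0)
  send := fun st => (st.1, st.2.2)
  recv := fun st ms =>
    let ps := (ms.filter (fun m => m.1 ∈ st.2.1)).map Prod.snd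
    (st.1, st.2.1, if st.2.2 = 0 ∧ 0 ∉ ps then leastUsedColor k ps else st.2.2)
  out := fun st => st.2.2

/-- Procedure Arbdefective-Coloring with parameters `k` and `t`, for `n`-vertex graphs of arboricity
at most `a`. As the subgraphs `G(H_i)` have maximum degree at most `⌊(2 + ε) a⌋`, a
`⌊⌊(2 + ε) a⌋ / (⌈2 + ε⌉ t)⌋`-defective coloring of them is `⌊a / t⌋`-defective. -/
noncomputable def arbdefectiveColoring (ε : ℝ) (D : ℕ → ℕ → ℕ → LocalAlg Unit ℕ)
    (n a k t r s : ℕ) : LocalAlg Unit ℕ :=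
  (partialOrientation ⌊(2 + ε) * a⌋₊ r (D n ⌊(2 + ε) * a⌋₊ (⌈2 + ε⌉₊ * t))).seq
    (simpleArbdefective k s)

/-! ### The coloring algorithm -/

/-- The parameter `k = t = ⌈a^{1/3}⌉`. -/
noncomputable def numParts (a : ℕ) : ℕ := ⌈(a : ℝ) ^ (1 / 3 : ℝ)⌉₊

/-- The bound `⌊(3 + ε) a^{2/3}⌋` on the arboricity of the parts. -/
noncomputable def partArboricity (ε : ℝ) (a : ℕ) : ℕ := ⌊(3 + ε) * (a : ℝ) ^ (2 / 3 : ℝ)⌋₊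

/-- The size `γ = ⌊(2 + ε) (3 + ε) a^{2/3}⌋ + 1` of the palette of a part. -/
noncomputable def paletteSize (ε : ℝ) (a : ℕ) : ℕ :=
  ⌊(2 + ε) * (3 + ε) * (a : ℝ) ^ (2 / 3 : ℝ)⌋₊ + 1

/-- The single invocation of Arbdefective-Coloring, with `k = t = ⌈a^{1/3}⌉`. -/
noncomputable def partitionStep (ε : ℝ) (D : ℕ → ℕ → ℕ → LocalAlg Unit ℕ) (n a r s : ℕ) :
    LocalAlg Unit ℕ :=
  arbdefectiveColoring ε D n a (numParts a) (numParts a) r s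

/-- The coloring algorithm: the single invocation of Arbdefective-Coloring, then the legal coloring
procedure `L` on all the parts `G_i` in parallel, then `φ(v) = (i - 1) γ + ψ_i(v)` for `v ∈ G_i`. -/
noncomputable def firstColoring (ε : ℝ) (D : ℕ → ℕ → ℕ → LocalAlg Unit ℕ)
    (L : ℕ → ℕ → LocalAlg Unit ℕ) (n a r s : ℕ) : LocalAlg Unit ℕ :=
  ((partitionStep ε D n a r s).seq (L n (partArboricity ε a)).onParts).mapOut
    (fun o => (o.1 - 1) * paletteSize ε a + o.2)

/-! In a graph of arboricity a, every vertex set S spans at most a|S| edges. Hence each round of the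
H-partition shrinks the active set by a factor of at least 1 + ε/2, and O(log n) rounds exhaust it
(`exists_hPartition_rounds`). A vertex of H_i has at most A = ⌊(2+ε)a⌋ neighbors outside H_1, …,
H_{i-1}; this bounds both the degrees inside G(H_i), where `D` runs, and the number of parents.

The pair (H-index, defective color) increases lexicographically along oriented edges. With r rounds
of H-partition and K = O(t²) defective colors, step (4) therefore ends within (r+1)K rounds
(`selectedColor_spec`). By pigeonhole a vertex shares its color with at most A/k parents, and it has
at most a/t unoriented edges. Directing the latter by identity number makes every color class
acyclically oriented with out-degree at most A/k + a/t, and numbering the outgoing edges splits the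
class into that many forests (`arboricityAtMost_of_key`). For k = t = ⌈a^{1/3}⌉ this is at most
(3+ε)a^{2/3}. Step (4) and `L` then both cost O(a^{2/3} log n), and k disjoint palettes of size
O(a^{2/3}) use O(a) colors.

The subroutines are constructed too. For `D`, colors are read as quadratic polynomials over prime
fields whose orders roughly halve from round to round, so that the added defects form a geometric
series dominated by its last term. For `L`, a legal O(b²)-coloring of the H-sets is reduced to O(b)
colors in O(b) rounds, and greedy coloring with A + 1 colors along the resulting total orientation
finishes. -/

open Classical in
/-- The finite set of the neighbours of `v`. -/
noncomputable def nbrs {V : Type u} [Fintype V] (G : SimpleGraph V) (v : V) : Finset V :=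
  Finset.univ.filter (fun u => G.Adj v u)

theorem mem_nbrs {V : Type u} [Fintype V] {G : SimpleGraph V} {v w : V} :
    w ∈ nbrs G v ↔ G.Adj v w := by
  simp [nbrs]

theorem ncard_neighbors_eq {V : Type u} [Fintype V] (G : SimpleGraph V) (v : V) (p : V → Prop)
    [DecidablePred p] : {w | G.Adj v w ∧ p w}.ncard = ((nbrs G v).filter p).card := by
  rw [← Set.ncard_coe_finset]
  congr 1
  ext w
  simp [mem_nbrs]

theorem ncard_neighborSet_eq {V : Type u} [Fintype V] (G : SimpleGraph V) (v : V) :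
    (G.neighborSet v).ncard = (nbrs G v).card := by
  rw [← Set.ncard_coe_finset]
  congr 1
  ext w
  simp [mem_nbrs]

/-! ### Semantics of sequential and parallel composition -/

namespace LocalAlg

variable {V : Type u} [Fintype V] (G : SimpleGraph V) (ident : V → ℕ)

theorem stateAt_zero {I O : Type} (P : LocalAlg I O) (inp : V → I) (v : V) :
    P.stateAt G ident inp 0 v = P.init (ident v) (inp v) := rfl

theorem stateAt_succ {I O : Type} (P : LocalAlg I O) (inp : V → I) (r : ℕ) (v : V) :
    P.stateAt G ident inp (r + 1) v = P.recv (P.stateAt G ident inp r v)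
      ((nbrs G v).val.map (fun u => P.send (P.stateAt G ident inp r u))) := rfl

theorem run_mapOut {I O O' : Type} (P : LocalAlg I O) (f : O → O') (inp : V → I) (v : V) :
    (P.mapOut f).run G ident inp v = f (P.run G ident inp v) := by
  have h : ∀ r v, (P.mapOut f).stateAt G ident inp r v = P.stateAt G ident inp r v := by
    intro r
    induction r with
    | zero => intro v; rfl
    | succ r ih =>
      intro v
      rw [stateAt_succ, stateAt_succ]
      simp only [ih]
      rfl
  exact congrArg (fun s => f (P.out s)) (h P.rounds v)

/-- All vertices switch phase simultaneously, so `filterMap` discards no message. The bound is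
strict because the receive step of the last round of `P` already installs the initial state of `Q`.
-/
theorem seq_stateAt_left {I M O : Type} (P : LocalAlg I M) (Q : LocalAlg M O) (inp : V → I) :
    ∀ r, r < P.rounds → ∀ v, (P.seq Q).stateAt G ident inp r v =
      (ident v, r, Sum.inl (P.stateAt G ident inp r v)) := by
  intro r
  induction r with
  | zero =>
    intro h v
    simp [stateAt_zero, seq, h.ne']
  | succ r ih =>
    intro h v
    rw [stateAt_succ, stateAt_succ]
    simp only [ih (by omega)]
    simp only [seq, Multiset.filterMap_map, Function.comp_def, Sum.getLeft?_inl, h.ne, if_false]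
    rw [← Multiset.filterMap_eq_map]
    rfl

theorem seq_stateAt_right {I M O : Type} (P : LocalAlg I M) (Q : LocalAlg M O) (inp : V → I) :
    ∀ r v, (P.seq Q).stateAt G ident inp (P.rounds + r) v =
      (ident v, P.rounds + r, Sum.inr (Q.stateAt G ident (P.run G ident inp) r v)) := by
  intro r
  induction r with
  | zero =>
    intro v
    -- The switch to `Q` happens in `init` if `P` takes no rounds, and in the last receive step of
    -- `P` otherwise.
    rcases Nat.eq_zero_or_pos P.rounds with h | h
    · simp [h, stateAt_zero, seq, run]
    · obtain ⟨k, hk⟩ : ∃ k, P.rounds = k + 1 := ⟨P.rounds - 1, by omega⟩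
      have hl := seq_stateAt_left G ident P Q inp k (by omega)
      have hr : P.run G ident inp v = P.out (P.stateAt G ident inp (k + 1) v) := by
        rw [run, hk]
      rw [add_zero, hk, stateAt_succ, stateAt_zero, hr, stateAt_succ]
      simp only [hl]
      simp only [seq, Multiset.filterMap_map, Function.comp_def, Sum.getLeft?_inl, hk, if_true]
      rw [← Multiset.filterMap_eq_map]
      rfl
  | succ r ih =>
    intro v
    rw [← add_assoc, stateAt_succ, stateAt_succ]
    simp only [ih]
    simp only [seq, Multiset.filterMap_map, Function.comp_def, Sum.getRight?_inr]
    rw [← Multiset.filterMap_eq_map]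
    rfl

theorem run_seq {I M O : Type} (P : LocalAlg I M) (Q : LocalAlg M O) (inp : V → I) :
    (P.seq Q).run G ident inp = Q.run G ident (P.run G ident inp) := by
  funext v
  have h := seq_stateAt_right G ident P Q inp Q.rounds v
  change (P.seq Q).out ((P.seq Q).stateAt G ident inp (P.rounds + Q.rounds) v) = _
  rw [h]
  rfl

open Classical in
/-- Parallel execution on the parts amounts to separate executions on the induced subgraphs. -/
theorem run_onParts {O : Type} (P : LocalAlg Unit O) (f : V → ℕ) (i : ℕ)
    (v : {v | f v = i}) :
    P.onParts.run G ident f v =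
      (i, P.run (G.induce {v | f v = i}) (fun v => ident v) (fun _ => ()) v) := by
  have h : ∀ r (v : {v | f v = i}), P.onParts.stateAt G ident f r v =
      (i, P.stateAt (G.induce {v | f v = i}) (fun v => ident v) (fun _ => ()) r v) := by
    -- Labels never change, so filtering messages by label amounts to restricting to the neighbors
    -- in the same part.
    have h1 : ∀ r v, (P.onParts.stateAt G ident f r v).1 = f v := by
      intro r
      induction r with
      | zero => intro v; rfl
      | succ r ih => intro v; rw [stateAt_succ]; exact ih v
    intro r
    induction r with
    | zero =>
      intro v
      have hv : f v = i := v.2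
      simp [stateAt_zero, onParts, hv]
    | succ r ih =>
      intro v
      rw [stateAt_succ, stateAt_succ]
      simp only [ih]
      change (i, P.recv _ _) = (i, P.recv _ _)
      congr 2
      have key : ∀ (g : V → ℕ × P.Msg) (s : Multiset V),
          ((s.map g).filter (fun m => m.1 = i)).map Prod.snd =
            (s.filter (fun u => (g u).1 = i)).map (fun u => (g u).2) := by
        intro g s
        rw [Multiset.filter_map, Multiset.map_map]
        rfl
      refine (key _ _).trans ?_
      have hn : (nbrs G (v : V)).filter (fun u => f u = i) =
          (nbrs (G.induce {v | f v = i}) v).map (Function.Embedding.subtype _) := by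
        ext w
        simp [mem_nbrs]
      have hf : Multiset.filter (fun u => (P.onParts.stateAt G ident f r u).1 = i)
          (nbrs G (v : V)).val =
          (nbrs (G.induce {v | f v = i}) v).val.map Subtype.val := by
        have := congrArg Finset.val hn
        rw [Finset.map_val, Finset.filter_val] at this
        refine Eq.trans ?_ this
        refine Multiset.filter_congr fun x _ => ?_
        rw [h1]
      refine (congrArg _ hf).trans ?_
      rw [Multiset.map_map]
      refine Multiset.map_congr rfl fun x _ => ?_
      change P.send (P.onParts.stateAt G ident f r x).2 = _
      rw [ih]
  have := h P.rounds v
  change P.onParts.out (P.onParts.stateAt G ident f P.rounds v) = _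
  rw [this]
  rfl

end LocalAlg

theorem IsIdentification.induce {V : Type u} {n : ℕ} {ident : V → ℕ} (h : IsIdentification n ident)
    (s : Set V) : IsIdentification n (fun v : s => ident v) :=
  ⟨fun _ _ e => Subtype.ext (h.1 e), fun v => h.2 v⟩

theorem IsIdentification.card_le {V : Type u} [Fintype V] {n : ℕ} {ident : V → ℕ}
    (h : IsIdentification n ident) : Fintype.card V ≤ n := by
  classical
  rw [← Finset.card_univ, ← Finset.card_image_of_injective _ h.1]
  refine (Finset.card_le_card (t := Finset.Icc 1 n) ?_).trans (by simp)
  intro x hx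
  obtain ⟨v, -, rfl⟩ := Finset.mem_image.1 hx
  exact Finset.mem_Icc.2 (h.2 v)

/-! ### Arboricity, acyclic orientations and edge counts -/

/-- If every vertex has at most one neighbour of greater key, there is no cycle. -/
theorem isAcyclic_of_greater_unique {V κ : Type*} [LinearOrder κ] (G : SimpleGraph V) (key : V → κ)
    (hkey : ∀ v w, G.Adj v w → key v ≠ key w)
    (h : ∀ v w w', G.Adj v w → G.Adj v w' → key v < key w → key v < key w' → w = w') :
    G.IsAcyclic := by
  classical
  intro x c hc
  -- At a vertex of minimum key on the cycle, the two distinct cycle neighbors both have greater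
  -- key.
  obtain ⟨v, hv, hmin⟩ := c.support.toFinset.exists_min_image key ⟨x, by simp⟩
  rw [List.mem_toFinset] at hv
  have hc' := hc.rotate hv
  have hnil := hc'.not_nil
  have hmem : ∀ w, w ∈ (c.rotate v hv).support → key v ≤ key w := by
    intro w hw
    exact hmin w (List.mem_toFinset.2 ((SimpleGraph.Walk.mem_support_rotate_iff ..).1 hw))
  have h1 := (c.rotate v hv).adj_snd hnil
  have h2 := ((c.rotate v hv).adj_penultimate hnil).symm
  refine hc'.snd_ne_penultimate (h v _ _ h1 h2
    (lt_of_le_of_ne (hmem _ ?_) (hkey _ _ h1)) (lt_of_le_of_ne (hmem _ ?_) (hkey _ _ h2)))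
  · exact SimpleGraph.Walk.getVert_mem_support _ _
  · exact SimpleGraph.Walk.getVert_mem_support _ _

/-- A graph with an acyclic orientation of out-degree at most `r` has arboricity at most `r`. -/
theorem arboricityAtMost_of_key {V : Type u} [Fintype V] {κ : Type*} [LinearOrder κ]
    (G : SimpleGraph V) (r : ℕ) (key : V → κ) (hkey : ∀ v w, G.Adj v w → key v ≠ key w)
    (hout : ∀ v, ((nbrs G v).filter (fun w => key v < key w)).card ≤ r) :
    ArboricityAtMost G r := by
  classical
  -- Number the outgoing edges of each vertex injectively; the edges numbered i form the i-th
  -- forest, as each vertex has at most one of them going out.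
  have hex : ∀ v, ∃ f : V → ℕ, ∀ w ∈ (nbrs G v).filter (fun w => key v < key w), f w < r ∧
      ∀ w' ∈ (nbrs G v).filter (fun w => key v < key w), f w = f w' → w = w' := by
    intro v
    set T := (nbrs G v).filter (fun w => key v < key w)
    refine ⟨fun w => if h : w ∈ T then (T.equivFin ⟨w, h⟩ : ℕ) else 0, fun w hw => ⟨?_, ?_⟩⟩
    · simp only [hw, dif_pos]
      exact (Fin.is_lt _).trans_le (hout v)
    · intro w' hw' e
      simp only [hw, hw', dif_pos] at e
      have := T.equivFin.injective (Fin.ext e)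
      exact congrArg Subtype.val this
  choose e he using hex
  have hmem : ∀ {v w}, G.Adj v w → key v < key w →
      w ∈ (nbrs G v).filter (fun w => key v < key w) := fun ha hl =>
    Finset.mem_filter.2 ⟨mem_nbrs.2 ha, hl⟩
  let F : Fin r → SimpleGraph V := fun i =>
    { Adj := fun v w => G.Adj v w ∧
        ((key v < key w ∧ e v w = i) ∨ (key w < key v ∧ e w v = i))
      symm := ⟨fun v w h => ⟨h.1.symm, h.2.symm⟩⟩
      loopless := ⟨fun v h => G.irrefl h.1⟩ }
  refine ⟨F, fun i => ?_, fun i j hij => ?_, ?_⟩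
  · refine isAcyclic_of_greater_unique (F i) key (fun v w h => hkey v w h.1) ?_
    rintro v w w' ⟨ha, hb⟩ ⟨ha', hb'⟩ hl hl'
    have h1 : e v w = i := hb.elim (fun h => h.2) (fun h => absurd hl h.1.not_gt)
    have h2 : e v w' = i := hb'.elim (fun h => h.2) (fun h => absurd hl' h.1.not_gt)
    exact (he v w (hmem ha hl)).2 w' (hmem ha' hl') (h1.trans h2.symm)
  · rw [SimpleGraph.disjoint_left]
    rintro v w ⟨ha, hb⟩ ⟨-, hb'⟩
    apply hij
    apply Fin.ext
    rcases hb with ⟨h, h1⟩ | ⟨h, h1⟩ <;> rcases hb' with ⟨h', h1'⟩ | ⟨h', h1'⟩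
    · exact h1.symm.trans h1'
    · exact absurd h h'.not_gt
    · exact absurd h h'.not_gt
    · exact h1.symm.trans h1'
  · ext v w
    rw [SimpleGraph.iSup_adj]
    constructor
    · intro ha
      rcases lt_or_gt_of_ne (hkey v w ha) with hl | hl
      · exact ⟨⟨e v w, (he v w (hmem ha hl)).1⟩, ha, Or.inl ⟨hl, rfl⟩⟩
      · exact ⟨⟨e w v, (he w v (hmem ha.symm hl)).1⟩, ha, Or.inr ⟨hl, rfl⟩⟩
    · rintro ⟨i, hi⟩
      exact hi.1

theorem degree_eq_card_nbrs {V : Type u} [Fintype V] (G : SimpleGraph V) [DecidableRel G.Adj]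
    (v : V) : G.degree v = (nbrs G v).card := by
  rw [← SimpleGraph.card_neighborFinset_eq_degree]
  congr 1
  ext w
  simp [mem_nbrs]

/-- A forest extends to a spanning tree of the complete graph, which has |V| - 1 edges; the
handshake identity doubles this. -/
theorem SimpleGraph.IsAcyclic.sum_card_nbrs_le {V : Type u} [Fintype V] {G : SimpleGraph V}
    (h : G.IsAcyclic) : ∑ v, (nbrs G v).card ≤ 2 * Fintype.card V := by
  classical
  rcases isEmpty_or_nonempty V with hV | hV
  · simp
  · obtain ⟨T, hGT, -, hT⟩ := SimpleGraph.connected_top.exists_isTree_le_of_le_of_isAcyclic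
      le_top h
    have h1 := T.sum_degrees_eq_twice_card_edges
    have h2 := hT.card_edgeFinset
    have h3 : ∑ v, (nbrs G v).card ≤ ∑ v, T.degree v := by
      refine Finset.sum_le_sum fun v _ => ?_
      rw [degree_eq_card_nbrs]
      exact Finset.card_le_card fun w hw => mem_nbrs.2 (hGT (mem_nbrs.1 hw))
    omega

theorem SimpleGraph.IsAcyclic.sum_card_nbrs_filter_le {V : Type u} [Fintype V] [DecidableEq V]
    {G : SimpleGraph V} (h : G.IsAcyclic) (S : Finset V) :
    ∑ v ∈ S, ((nbrs G v).filter (· ∈ S)).card ≤ 2 * S.card := by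
  have h1 := (h.induce (S : Set V)).sum_card_nbrs_le
  have h2 : Fintype.card (S : Set V) = S.card := by simp
  rw [h2] at h1
  refine le_trans (le_of_eq ?_) h1
  rw [← Finset.sum_coe_sort S]
  refine Finset.sum_congr rfl fun v _ => ?_
  rw [← Finset.card_map (Function.Embedding.subtype _)]
  congr 1
  ext w
  simp [mem_nbrs]

/-- An induced subgraph with `m` vertices of a graph of arboricity at most `a` has at most `a m`
edges. -/
theorem ArboricityAtMost.sum_card_nbrs_filter_le {V : Type u} [Fintype V] [DecidableEq V]
    {G : SimpleGraph V} {a : ℕ} (h : ArboricityAtMost G a) (S : Finset V) :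
    ∑ v ∈ S, ((nbrs G v).filter (· ∈ S)).card ≤ 2 * a * S.card := by
  obtain ⟨F, hF, -, rfl⟩ := h
  have h1 : ∀ v, ((nbrs (⨆ i, F i) v).filter (· ∈ S)).card ≤
      ∑ i, ((nbrs (F i) v).filter (· ∈ S)).card := by
    intro v
    refine (Finset.card_le_card ?_).trans Finset.card_biUnion_le
    intro w hw
    simpa [mem_nbrs] using hw
  calc _ ≤ ∑ v ∈ S, ∑ i, ((nbrs (F i) v).filter (· ∈ S)).card := Finset.sum_le_sum fun v _ => h1 v
    _ = ∑ i, ∑ v ∈ S, ((nbrs (F i) v).filter (· ∈ S)).card := Finset.sum_comm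
    _ ≤ ∑ _i : Fin a, 2 * S.card := Finset.sum_le_sum fun i _ => (hF i).sum_card_nbrs_filter_le S
    _ = _ := by simp; ring

/-! ### The H-partition -/

section HPartition

variable {V : Type u} [Fintype V] (G : SimpleGraph V) (ident : V → ℕ) (A r : ℕ)

/-- The `H`-index of a vertex after `t` rounds, `0` for an active vertex. -/
noncomputable def hIndex (t : ℕ) (v : V) : ℕ :=
  ((hPartition A 0).stateAt G ident (fun _ => ()) t v).2

/-- The vertices that are active after `t` rounds. -/
noncomputable def activeSet (t : ℕ) : Finset V :=
  Finset.univ.filter (fun v => hIndex G ident A t v = 0)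

theorem hPartition_stateAt (t : ℕ) (v : V) :
    (hPartition A 0).stateAt G ident (fun _ => ()) t v = (t, hIndex G ident A t v) := by
  refine Prod.ext ?_ rfl
  induction t with
  | zero => rfl
  | succ t ih => exact congrArg (· + 1) ih

/-- The duration only determines when to stop and does not affect the transitions, so duration 0 can
serve as the reference for all states. -/
theorem hPartition_run (v : V) :
    (hPartition A r).run G ident (fun _ => ()) v = hIndex G ident A r v := by
  have h : ∀ t v, (hPartition A r).stateAt G ident (fun _ => ()) t v =
      (hPartition A 0).stateAt G ident (fun _ => ()) t v := by
    intro t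
    induction t with
    | zero => intro v; rfl
    | succ t ih =>
      intro v
      rw [LocalAlg.stateAt_succ, LocalAlg.stateAt_succ]
      simp only [ih]
      rfl
  exact congrArg Prod.snd (h r v)

theorem hIndex_zero (v : V) : hIndex G ident A 0 v = 0 := rfl

theorem hIndex_succ (t : ℕ) (v : V) : hIndex G ident A (t + 1) v =
    if hIndex G ident A t v = 0 ∧
      ((nbrs G v).filter (fun w => hIndex G ident A t w = 0)).card ≤ A then t + 1
    else hIndex G ident A t v := by
  have h : hIndex G ident A (t + 1) v = ((hPartition A 0).recv (t, hIndex G ident A t v)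
      ((nbrs G v).val.map fun w => (hPartition A 0).send (t, hIndex G ident A t w))).2 := by
    rw [hIndex, LocalAlg.stateAt_succ]
    simp only [hPartition_stateAt]
  rw [h]
  change (if hIndex G ident A t v = 0 ∧ Multiset.count true ((nbrs G v).val.map
    fun w => decide (hIndex G ident A t w = 0)) ≤ A then t + 1 else hIndex G ident A t v) = _
  have hcard : Multiset.count true ((nbrs G v).val.map
      fun w => decide (hIndex G ident A t w = 0)) =
      ((nbrs G v).filter (fun w => hIndex G ident A t w = 0)).card := by
    rw [Multiset.count_map, Finset.card_def, Finset.filter_val]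
    exact congrArg _ (Multiset.filter_congr fun w _ => by simp)
  rw [hcard]

theorem hIndex_le (t : ℕ) (v : V) : hIndex G ident A t v ≤ t := by
  induction t with
  | zero => simp [hIndex_zero]
  | succ t ih =>
    rw [hIndex_succ]
    split_ifs
    · exact le_rfl
    · omega

/-- A vertex of `H_i` has at most `A` neighbours that are not in `H_1, …, H_{i-1}`. -/
theorem hIndex_later_nbrs_le (t : ℕ) (v : V) (h : hIndex G ident A t v ≠ 0) :
    ((nbrs G v).filter (fun w => hIndex G ident A t w = 0 ∨
      hIndex G ident A t v ≤ hIndex G ident A t w)).card ≤ A := by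
  induction t with
  | zero => exact absurd (hIndex_zero G ident A v) h
  | succ t ih =>
    by_cases hc : hIndex G ident A t v = 0 ∧
        ((nbrs G v).filter (fun w => hIndex G ident A t w = 0)).card ≤ A
    -- Here `v` joins in round t + 1. Indices were at most t before, so a neighbor that is now
    -- active or of index at least t + 1 was active at time t.
    · refine (Finset.card_le_card ?_).trans hc.2
      intro w hw
      rw [Finset.mem_filter] at hw ⊢
      refine ⟨hw.1, ?_⟩
      have h1 := hw.2
      have h2 := hIndex_le G ident A t w
      rw [hIndex_succ G ident A t v, if_pos hc, hIndex_succ G ident A t w] at h1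
      split_ifs at h1 with h3
      · exact h3.1
      · omega
    · have hv : hIndex G ident A (t + 1) v = hIndex G ident A t v := by
        rw [hIndex_succ, if_neg hc]
      rw [hv] at h ⊢
      refine (Finset.card_le_card ?_).trans (ih h)
      intro w hw
      rw [Finset.mem_filter] at hw ⊢
      refine ⟨hw.1, ?_⟩
      have h1 := hw.2
      rw [hIndex_succ G ident A t w] at h1
      split_ifs at h1 with h3
      · exact Or.inl h3.1
      · exact h1

/-- A vertex that stays active has at least A + 1 active neighbors, while the degrees inside the
active set sum to at most 2a times its size. -/
theorem card_activeSet_succ {a : ℕ} (ha : ArboricityAtMost G a) (t : ℕ) :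
    (A + 1) * (activeSet G ident A (t + 1)).card ≤ 2 * a * (activeSet G ident A t).card := by
  classical
  refine le_trans ?_ (ha.sum_card_nbrs_filter_le (activeSet G ident A t))
  have hsub : activeSet G ident A (t + 1) ⊆ activeSet G ident A t := by
    intro v hv
    simp only [activeSet, Finset.mem_filter, Finset.mem_univ, true_and] at hv ⊢
    rw [hIndex_succ] at hv
    split_ifs at hv with h
    exact hv
  calc (A + 1) * (activeSet G ident A (t + 1)).card
      = ∑ _v ∈ activeSet G ident A (t + 1), (A + 1) := by simp [mul_comm]
    _ ≤ ∑ v ∈ activeSet G ident A (t + 1),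
        ((nbrs G v).filter (· ∈ activeSet G ident A t)).card := by
      refine Finset.sum_le_sum fun v hv => ?_
      by_contra hlt
      have h0 := hsub hv
      simp only [activeSet, Finset.mem_filter, Finset.mem_univ, true_and] at hv h0 hlt
      rw [hIndex_succ, if_pos ⟨h0, by omega⟩] at hv
      omega
    _ ≤ _ := Finset.sum_le_sum_of_subset hsub

theorem card_activeSet_le {a : ℕ} (ha : ArboricityAtMost G a) (t : ℕ) :
    (A + 1) ^ t * (activeSet G ident A t).card ≤ (2 * a) ^ t * Fintype.card V := by
  induction t with
  | zero => simpa using Finset.card_le_univ _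
  | succ t ih =>
    calc (A + 1) ^ (t + 1) * (activeSet G ident A (t + 1)).card
        = (A + 1) ^ t * ((A + 1) * (activeSet G ident A (t + 1)).card) := by ring
      _ ≤ (A + 1) ^ t * (2 * a * (activeSet G ident A t).card) :=
        Nat.mul_le_mul_left _ (card_activeSet_succ G ident A ha t)
      _ = 2 * a * ((A + 1) ^ t * (activeSet G ident A t).card) := by ring
      _ ≤ 2 * a * ((2 * a) ^ t * Fintype.card V) := Nat.mul_le_mul_left _ ih
      _ = _ := by ring

end HPartition

/-- The `H`-partition of degree `⌊(2 + ε) a⌋` is complete after `O(log n)` rounds. -/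
theorem exists_hPartition_rounds (ε : ℝ) (hε : 0 < ε) : ∃ c : ℕ, ∀ n a : ℕ, 1 ≤ a →
    ∀ (V : Type u) [Fintype V] (G : SimpleGraph V) (ident : V → ℕ),
      Fintype.card V ≤ n → ArboricityAtMost G a → ∀ v,
        1 ≤ hIndex G ident ⌊(2 + ε) * a⌋₊ (c * (Nat.log 2 n + 1)) v := by
  -- Since A + 1 ≥ (2+ε)a, the active set shrinks by 1 + ε/2 per round, hence by more than 2 in c
  -- rounds; log n + 1 such blocks leave fewer than one vertex.
  obtain ⟨c, hc⟩ := pow_unbounded_of_one_lt 2 (show 1 < 1 + ε / 2 by linarith)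
  refine ⟨c, fun n a ha V _ G ident hn hG v => ?_⟩
  by_contra hv
  set A := ⌊(2 + ε) * a⌋₊
  set r := c * (Nat.log 2 n + 1)
  have h1 := card_activeSet_le G ident A hG r
  have h2 : 1 ≤ (activeSet G ident A r).card :=
    Finset.card_pos.2 ⟨v, Finset.mem_filter.2 ⟨Finset.mem_univ _, by omega⟩⟩
  have h3 : (A + 1) ^ r ≤ (2 * a) ^ r * n :=
    (Nat.le_mul_of_pos_right _ h2).trans (h1.trans (Nat.mul_le_mul_left _ hn))
  have h4 : (n : ℝ) < (1 + ε / 2) ^ r := by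
    have h5 : n < 2 ^ (Nat.log 2 n + 1) := Nat.lt_pow_succ_log_self (by norm_num) n
    calc (n : ℝ) < 2 ^ (Nat.log 2 n + 1) := by exact_mod_cast h5
      _ ≤ ((1 + ε / 2) ^ c) ^ (Nat.log 2 n + 1) := pow_le_pow_left₀ (by norm_num) hc.le _
      _ = _ := (pow_mul _ _ _).symm
  have h6 : (2 + ε) * a ≤ (A + 1 : ℝ) := (Nat.lt_floor_add_one _).le
  have ha' : (1 : ℝ) ≤ a := by exact_mod_cast ha
  have h7 : ((2 + ε) * a) ^ r ≤ (2 * a : ℝ) ^ r * n := by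
    calc ((2 + ε) * a) ^ r ≤ (A + 1 : ℝ) ^ r := pow_le_pow_left₀ (by positivity) h6 _
      _ ≤ _ := by exact_mod_cast h3
  have h8 : ((2 + ε) * a) ^ r = (2 * a : ℝ) ^ r * (1 + ε / 2) ^ r := by
    rw [← mul_pow]
    congr 1
    ring
  rw [h8] at h7
  have h9 : (0 : ℝ) < (2 * a : ℝ) ^ r := by positivity
  exact absurd (le_of_mul_le_mul_left h7 h9) h4.not_ge

theorem log_add_one_le_two_mul_logb {n : ℕ} (hn : 2 ≤ n) :
    ((Nat.log 2 n + 1 : ℕ) : ℝ) ≤ 2 * Real.logb 2 n := by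
  have h1 : (Nat.log 2 n : ℝ) ≤ Real.logb 2 n := by
    rw [Real.le_logb_iff_rpow_le (by norm_num) (by positivity), Real.rpow_natCast]
    exact_mod_cast Nat.pow_log_le_self 2 (by omega)
  have h2 : 1 ≤ Nat.log 2 n := Nat.log_pos (by norm_num) hn
  have h3 : (1 : ℝ) ≤ Nat.log 2 n := by exact_mod_cast h2
  push_cast
  linarith

theorem one_le_logb_two {n : ℕ} (hn : 2 ≤ n) : 1 ≤ Real.logb 2 n := by
  rw [Real.le_logb_iff_rpow_le (by norm_num) (by positivity)]
  norm_num
  exact_mod_cast hn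

/-! ### Greedy selection of least used colors -/

theorem leastUsedColor_spec {k : ℕ} (hk : 1 ≤ k) (cs : Multiset ℕ) :
    (1 ≤ leastUsedColor k cs ∧ leastUsedColor k cs ≤ k) ∧
      k * cs.count (leastUsedColor k cs) ≤ cs.card := by
  have hex : ∃ c, (List.range' 1 k).argmin (fun c => cs.count c) = some c := by
    rw [← Option.ne_none_iff_exists']
    intro h
    rw [List.argmin_eq_none] at h
    have := congrArg List.length h
    simp at this
    omega
  obtain ⟨c, hc⟩ := hex
  have hl : leastUsedColor k cs = c := by rw [leastUsedColor, hc]; rfl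
  rw [hl]
  have hmem := List.argmin_mem (Option.mem_def.2 hc)
  rw [List.mem_range'_1] at hmem
  refine ⟨⟨hmem.1, by omega⟩, ?_⟩
  calc k * cs.count c = ∑ _i ∈ Finset.Icc 1 k, cs.count c := by simp
    _ ≤ ∑ i ∈ Finset.Icc 1 k, cs.count i := by
      refine Finset.sum_le_sum fun i hi => ?_
      rw [Finset.mem_Icc] at hi
      exact List.le_of_mem_argmin (f := fun c => cs.count c)
        (List.mem_range'_1.2 ⟨hi.1, by omega⟩) hc
    _ ≤ cs.card := by
      classical
      rw [← Finset.sum_filter_add_sum_filter_not (s := Finset.Icc 1 k) (p := (· ∈ cs.toFinset))]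
      rw [Finset.sum_eq_zero (s := {x ∈ Finset.Icc 1 k | x ∉ cs.toFinset})
        (fun x hx => Multiset.count_eq_zero.2
          (fun h => (Finset.mem_filter.1 hx).2 (Multiset.mem_toFinset.2 h))), add_zero,
        ← Multiset.toFinset_sum_count_eq cs]
      exact Finset.sum_le_sum_of_subset fun x hx => (Finset.mem_filter.1 hx).2

section SimpleArbdefective

variable {V : Type u} [Fintype V] (G : SimpleGraph V) (ident : V → ℕ)

/-- The color (or `0`) of a vertex after `t` rounds of Procedure Simple-Arbdefective. -/
noncomputable def selectedColor (k : ℕ) (S : V → Finset ℕ) (t : ℕ) (v : V) : ℕ :=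
  ((simpleArbdefective k 0).stateAt G ident S t v).2.2

theorem simpleArbdefective_stateAt (k : ℕ) (S : V → Finset ℕ) (t : ℕ) (v : V) :
    (simpleArbdefective k 0).stateAt G ident S t v =
      (ident v, S v, selectedColor G ident k S t v) := by
  have h : ∀ t v, ((simpleArbdefective k 0).stateAt G ident S t v).1 = ident v ∧
      ((simpleArbdefective k 0).stateAt G ident S t v).2.1 = S v := by
    intro t
    induction t with
    | zero => intro v; exact ⟨rfl, rfl⟩
    | succ t ih => intro v; exact ih v
  exact Prod.ext (h t v).1 (Prod.ext (h t v).2 rfl)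

theorem simpleArbdefective_run (k s : ℕ) (S : V → Finset ℕ) (v : V) :
    (simpleArbdefective k s).run G ident S v = selectedColor G ident k S s v := by
  have h : ∀ t v, (simpleArbdefective k s).stateAt G ident S t v =
      (simpleArbdefective k 0).stateAt G ident S t v := by
    intro t
    induction t with
    | zero => intro v; rfl
    | succ t ih =>
      intro v
      rw [LocalAlg.stateAt_succ, LocalAlg.stateAt_succ]
      simp only [ih]
      rfl
  exact congrArg (fun st => st.2.2) (h s v)

variable {G ident} {par : V → Finset V}

theorem selectedColor_zero (k : ℕ) (v : V) :
    selectedColor G ident k (fun v => (par v).image ident) 0 v =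
      if (par v).image ident = ∅ then leastUsedColor k 0 else 0 := rfl

/-- Parents are known only by identity number. Injectivity of `ident` ensures that filtering the
messages by identity keeps exactly those of the parents. -/
theorem selectedColor_succ (hid : Function.Injective ident) (hpar : ∀ v, par v ⊆ nbrs G v)
    (k t : ℕ) (v : V) :
    selectedColor G ident k (fun v => (par v).image ident) (t + 1) v =
      if selectedColor G ident k (fun v => (par v).image ident) t v = 0 ∧
        0 ∉ (par v).val.map (selectedColor G ident k (fun v => (par v).image ident) t)
      then leastUsedColor k
        ((par v).val.map (selectedColor G ident k (fun v => (par v).image ident) t))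
      else selectedColor G ident k (fun v => (par v).image ident) t v := by
  classical
  set S : V → Finset ℕ := fun v => (par v).image ident with hS
  set χ := selectedColor G ident k S t with hχ
  have h : selectedColor G ident k S (t + 1) v = ((simpleArbdefective k 0).recv
      (ident v, S v, χ v)
      ((nbrs G v).val.map fun w => (simpleArbdefective k 0).send (ident w, S w, χ w))).2.2 := by
    rw [selectedColor, LocalAlg.stateAt_succ]
    simp only [simpleArbdefective_stateAt]
    rfl
  have hps : ((((nbrs G v).val.map fun w => ((ident w, χ w) : ℕ × ℕ))).filter
      (fun m => m.1 ∈ S v)).map Prod.snd = (par v).val.map χ := by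
    rw [Multiset.filter_map, Multiset.map_map]
    have : Multiset.filter ((fun m : ℕ × ℕ => m.1 ∈ S v) ∘ fun w => (ident w, χ w))
        (nbrs G v).val = (par v).val := by
      have hf : (nbrs G v).filter (· ∈ par v) = par v := by
        ext w
        simp only [Finset.mem_filter, and_iff_right_iff_imp]
        exact fun hw => hpar v hw
      refine Eq.trans ?_ (congrArg Finset.val hf)
      rw [Finset.filter_val]
      refine Multiset.filter_congr fun w _ => ?_
      simp only [Function.comp, hS, Finset.mem_image]
      exact ⟨fun ⟨x, hx, e⟩ => hid e ▸ hx, fun hw => ⟨w, hw, rfl⟩⟩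
    rw [this]
    rfl
  rw [h, ← hps]
  rfl

/-- The height `f` increases strictly towards parents and stays below `N`, which bounds the length
of a chain of waiting vertices. -/
theorem selectedColor_spec (hid : Function.Injective ident) (hpar : ∀ v, par v ⊆ nbrs G v)
    {k : ℕ} (hk : 1 ≤ k) (f : V → ℕ) (N : ℕ) (hf : ∀ v, ∀ w ∈ par v, f v < f w)
    (hN : ∀ v, f v < N) (s : ℕ) (hs : N ≤ s + 1) (v : V) :
    (1 ≤ selectedColor G ident k (fun v => (par v).image ident) s v ∧
      selectedColor G ident k (fun v => (par v).image ident) s v ≤ k) ∧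
    k * ((par v).filter fun w => selectedColor G ident k (fun v => (par v).image ident) s w =
      selectedColor G ident k (fun v => (par v).image ident) s v).card ≤ (par v).card := by
  set χ := selectedColor G ident k (fun v => (par v).image ident) with hχ
  have hsucc := selectedColor_succ hid hpar k
  rw [← hχ] at hsucc
  have hstable : ∀ t v, χ t v ≠ 0 → χ (t + 1) v = χ t v := by
    intro t v h
    rw [hsucc, if_neg (fun h' => h h'.1)]
  -- The parents had selected before `v` did, and selected colors are frozen; so the choice of `v`
  -- is still least used for the current colors of its parents.
  have hinv : ∀ t v, χ t v ≠ 0 →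
      (∀ w ∈ par v, χ t w ≠ 0) ∧ χ t v = leastUsedColor k ((par v).val.map (χ t)) := by
    intro t
    induction t with
    | zero =>
      intro v h
      have h0 : χ 0 v = if (par v).image ident = ∅ then leastUsedColor k 0 else 0 :=
        selectedColor_zero k v
      rw [h0] at h
      split_ifs at h with he
      · rw [h0, if_pos he, Finset.image_eq_empty.1 he]
        simp
      · exact absurd rfl h
    | succ t ih =>
      have hmap : ∀ v, (∀ w ∈ par v, χ t w ≠ 0) →
          (∀ w ∈ par v, χ (t + 1) w ≠ 0) ∧
            (par v).val.map (χ (t + 1)) = (par v).val.map (χ t) := by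
        intro v hv
        refine ⟨fun w hw => ?_, Multiset.map_congr rfl fun w hw => hstable t w (hv w hw)⟩
        rw [hstable t w (hv w hw)]
        exact hv w hw
      intro v h
      by_cases hc : χ t v = 0
      · rw [hsucc] at h
        split_ifs at h with h'
        · have hall : ∀ w ∈ par v, χ t w ≠ 0 := fun w hw e =>
            h'.2 (Multiset.mem_map.2 ⟨w, hw, e⟩)
          refine ⟨(hmap v hall).1, ?_⟩
          rw [(hmap v hall).2, hsucc, if_pos h']
        · exact absurd hc h
      · obtain ⟨h1, h2⟩ := ih v hc
        refine ⟨(hmap v h1).1, ?_⟩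
        rw [(hmap v h1).2, hstable t v hc]
        exact h2
  -- Downward induction on the height: a vertex of height N - 1 has no parents and selects in
  -- `init`, before any communication.
  have hprog : ∀ t v, N ≤ f v + t + 1 → χ t v ≠ 0 := by
    intro t
    induction t with
    | zero =>
      intro v h
      have he : par v = ∅ := Finset.eq_empty_of_forall_notMem fun w hw => by
        have := hf v w hw
        have := hN w
        omega
      have h0 : χ 0 v = if (par v).image ident = ∅ then leastUsedColor k 0 else 0 :=
        selectedColor_zero k v
      rw [h0, if_pos (by rw [he, Finset.image_empty])]
      have := (leastUsedColor_spec hk 0).1.1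
      omega
    | succ t ih =>
      intro v h
      by_cases hc : χ t v = 0
      · have hz : 0 ∉ (par v).val.map (χ t) := by
          intro hm
          obtain ⟨w, hw, e⟩ := Multiset.mem_map.1 hm
          have := hf v w hw
          exact ih w (by omega) e
        rw [hsucc, if_pos ⟨hc, hz⟩]
        exact Nat.one_le_iff_ne_zero.1 (leastUsedColor_spec hk ((par v).val.map (χ t))).1.1
      · rwa [hstable t v hc]
  obtain ⟨-, h2⟩ := hinv s v (hprog s v (by omega))
  have h3 := leastUsedColor_spec hk ((par v).val.map (χ s))
  rw [← h2] at h3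
  refine ⟨h3.1, le_trans (le_of_eq ?_) (h3.2.trans_eq (Multiset.card_map _ _))⟩
  rw [Multiset.count_map, Finset.card_def, Finset.filter_val]
  congr 2
  exact Multiset.filter_congr fun w _ => eq_comm

end SimpleArbdefective

/-! ### Partial orientation and the coloring derived from it -/

section Orientation

variable {V : Type u} [Fintype V] (G : SimpleGraph V) (ident : V → ℕ)

/-- The neighbours towards which the edges of `v` are oriented, for the labels `l`. -/
noncomputable def parentSet (l : V → ℕ × ℕ) (v : V) : Finset V :=
  (nbrs G v).filter fun w => (l v).1 < (l w).1 ∨ ((l v).1 = (l w).1 ∧ (l v).2 < (l w).2)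

theorem orientEdges_run (l : V → ℕ × ℕ) (v : V) :
    orientEdges.run G ident l v = (parentSet G l v).image ident := by
  have h : orientEdges.run G ident l v = ((((nbrs G v).val.map fun u => (ident u, l u)).filter
      (fun m => (l v).1 < m.2.1 ∨ ((l v).1 = m.2.1 ∧ (l v).2 < m.2.2))).map
      Prod.fst).toFinset := rfl
  rw [h]
  ext x
  simp only [Multiset.mem_toFinset, Multiset.mem_map, Multiset.mem_filter, Finset.mem_image,
    parentSet, Finset.mem_filter, Finset.mem_val]
  constructor
  · rintro ⟨_, ⟨⟨w, hw, rfl⟩, hl⟩, rfl⟩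
    exact ⟨w, ⟨hw, hl⟩, rfl⟩
  · rintro ⟨w, ⟨hw, hl⟩, rfl⟩
    exact ⟨_, ⟨⟨w, hw, rfl⟩, hl⟩, rfl⟩

/-- What Procedure Partial-Orientation guarantees: the labels consisting of `H`-index and defective
color have the listed properties. -/
structure IsOrientationLabeling (A r m K : ℕ) (l : V → ℕ × ℕ) : Prop where
  fst_le : ∀ v, (l v).1 ≤ r
  snd_pos : ∀ v, 1 ≤ (l v).2
  snd_le : ∀ v, (l v).2 ≤ K
  card_parentSet_le : ∀ v, (parentSet G l v).card ≤ A
  card_unoriented_le : ∀ v, ((nbrs G v).filter fun w => l w = l v).card ≤ m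

variable {G ident}

/-- Completeness of the H-partition matters: only the classes of positive index have their degrees
bounded by `A`, as `D` requires. -/
theorem partialOrientation_spec {n A r m K : ℕ} {D : LocalAlg Unit ℕ}
    (hD : ∀ (W : Type u) [Fintype W] (G' : SimpleGraph W) (ident' : W → ℕ),
      IsIdentification n ident' → (∀ v, (G'.neighborSet v).ncard ≤ A) →
      IsDefectiveColoring G' m K (D.run G' ident' fun _ => ()))
    (hid : IsIdentification n ident) (hH : ∀ v, 1 ≤ hIndex G ident A r v) :
    ∃ l : V → ℕ × ℕ, IsOrientationLabeling G A r m K l ∧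
      (partialOrientation A r D).run G ident (fun _ => ()) =
        fun v => (parentSet G l v).image ident := by
  classical
  set H : V → ℕ := hIndex G ident A r with hHdef
  have hrunH : (hPartition A r).run G ident (fun _ => ()) = H :=
    funext fun v => hPartition_run G ident A r v
  set l : V → ℕ × ℕ := D.onParts.run G ident H with hl
  have hdeg : ∀ i (v : {v | H v = i}), ((G.induce {v | H v = i}).neighborSet v).ncard ≤ A := by
    intro i v
    have hv : H v = i := v.2
    rw [ncard_neighborSet_eq, ← Finset.card_map (Function.Embedding.subtype _)]
    refine (Finset.card_le_card ?_).trans (hIndex_later_nbrs_le G ident A r v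
      (Nat.one_le_iff_ne_zero.1 (hH v)))
    · intro w hw
      obtain ⟨x, hx, rfl⟩ := Finset.mem_map.1 hw
      rw [mem_nbrs] at hx
      refine Finset.mem_filter.2 ⟨mem_nbrs.2 hx, Or.inr ?_⟩
      have hx' : H x = i := x.2
      change H v ≤ H x
      rw [hx', hv]
  have hcol := fun i => hD {v | H v = i} (G.induce {v | H v = i}) (fun v => ident v)
    (hid.induce _) (hdeg i)
  have hlv : ∀ v, l v = (H v, D.run (G.induce {w | H w = H v}) (fun v => ident v)
      (fun _ => ()) ⟨v, rfl⟩) := fun v =>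
    LocalAlg.run_onParts G ident D H (H v) ⟨v, rfl⟩
  have hl1 : ∀ v, (l v).1 = H v := fun v => by rw [hlv]
  refine ⟨l, ⟨fun v => ?_, fun v => ?_, fun v => ?_, fun v => ?_, fun v => ?_⟩, ?_⟩
  · rw [hl1]
    exact hIndex_le G ident A r v
  · rw [hlv]
    exact ((hcol (H v)).1 _).1
  · rw [hlv]
    exact ((hcol (H v)).1 _).2
  · refine (Finset.card_le_card ?_).trans (hIndex_later_nbrs_le G ident A r v
      (Nat.one_le_iff_ne_zero.1 (hH v)))
    intro w hw
    obtain ⟨hw1, hw2⟩ := Finset.mem_filter.1 hw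
    rw [hl1, hl1] at hw2
    exact Finset.mem_filter.2 ⟨hw1, Or.inr (by change H v ≤ H w; omega)⟩
  · refine le_trans (le_of_eq ?_) ((hcol (H v)).2 ⟨v, rfl⟩)
    rw [ncard_neighbors_eq, ← Finset.card_map (Function.Embedding.subtype _)]
    congr 1
    ext w
    simp only [Finset.mem_filter, mem_nbrs, Finset.mem_map, Function.Embedding.subtype_apply]
    constructor
    · rintro ⟨ha, he⟩
      have hw : H w = H v := by rw [← hl1, ← hl1, he]
      refine ⟨⟨w, hw⟩, ⟨ha, ?_⟩, rfl⟩
      have h1 : l w = _ := LocalAlg.run_onParts G ident D H (H v) ⟨w, hw⟩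
      rw [h1, hlv v] at he
      exact congrArg Prod.snd he
    · rintro ⟨x, ⟨ha, he⟩, rfl⟩
      refine ⟨ha, ?_⟩
      have h1 : l x = _ := LocalAlg.run_onParts G ident D H (H v) x
      rw [h1, hlv v, he]
  · funext v
    rw [partialOrientation, LocalAlg.run_seq, LocalAlg.run_seq, hrunH, orientEdges_run]

variable {A r m K : ℕ} {l : V → ℕ × ℕ}

/-- Procedure Simple-Arbdefective on the orientation given by the labels `l`. -/
theorem IsOrientationLabeling.simpleArbdefective_spec (hl : IsOrientationLabeling G A r m K l)
    (hid : Function.Injective ident) {k s : ℕ} (hk : 1 ≤ k) (hs : (r + 1) * K ≤ s) (v : V) :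
    (1 ≤ (simpleArbdefective k s).run G ident (fun v => (parentSet G l v).image ident) v ∧
      (simpleArbdefective k s).run G ident (fun v => (parentSet G l v).image ident) v ≤ k) ∧
    ((parentSet G l v).filter fun w =>
      (simpleArbdefective k s).run G ident (fun v => (parentSet G l v).image ident) w =
      (simpleArbdefective k s).run G ident (fun v => (parentSet G l v).image ident) v).card
        ≤ A / k := by
  simp only [simpleArbdefective_run]
  -- The height encodes the lexicographic order of the labels. Since second components lie in [1,
  -- K], a larger H-index outweighs any color.
  have hspec := selectedColor_spec (G := G) (par := parentSet G l) hid
    (fun v => Finset.filter_subset _ _) hk (fun v => (l v).1 * K + (l v).2) ((r + 1) * K + 1)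
    (fun v w hw => ?_) (fun v => ?_) s (by omega) v
  · refine ⟨hspec.1, (Nat.le_div_iff_mul_le (by omega)).2 ?_⟩
    rw [mul_comm]
    exact hspec.2.trans (hl.card_parentSet_le v)
  · have h1 := hl.snd_le v
    have h2 := hl.snd_pos w
    rcases (Finset.mem_filter.1 hw).2 with h | ⟨h, h'⟩
    · have := Nat.mul_le_mul_right K (Nat.succ_le_of_lt h)
      rw [Nat.succ_mul] at this
      omega
    · rw [h]
      omega
  · have h1 := hl.snd_le v
    have := Nat.mul_le_mul_right K (hl.fst_le v)
    rw [Nat.succ_mul]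
    omega

/-- Defect 0 leaves no edge unoriented, and with A + 1 colors for at most A parents some color is
unused by them: A / (A + 1) = 0. -/
theorem IsOrientationLabeling.isLegalColoring (hl : IsOrientationLabeling G A r 0 K l)
    (hid : Function.Injective ident) {s : ℕ} (hs : (r + 1) * K ≤ s) :
    IsLegalColoring G (A + 1) ((simpleArbdefective (A + 1) s).run G ident
      (fun v => (parentSet G l v).image ident)) := by
  have hspec := hl.simpleArbdefective_spec hid (k := A + 1) (by omega) hs
  refine ⟨fun v => (hspec v).1, ?_⟩
  set φ := (simpleArbdefective (A + 1) s).run G ident (fun v => (parentSet G l v).image ident)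
  have hpar : ∀ v w, w ∈ parentSet G l v → φ w ≠ φ v := by
    intro v w hw e
    have h1 := (hspec v).2
    rw [Nat.div_eq_of_lt (Nat.lt_succ_self A), Nat.le_zero, Finset.card_eq_zero] at h1
    exact Finset.notMem_empty w (h1 ▸ Finset.mem_filter.2 ⟨hw, e⟩)
  intro v w ha e
  by_cases hvw : w ∈ parentSet G l v
  · exact hpar v w hvw e.symm
  by_cases hwv : v ∈ parentSet G l w
  · exact hpar w v hwv e
  have h0 := hl.card_unoriented_le v
  rw [Nat.le_zero, Finset.card_eq_zero] at h0
  refine Finset.notMem_empty w (h0 ▸ Finset.mem_filter.2 ⟨mem_nbrs.2 ha, ?_⟩)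
  simp only [parentSet, Finset.mem_filter, mem_nbrs, ha, ha.symm, true_and] at hvw hwv
  exact Prod.ext (by omega) (by omega)

theorem IsOrientationLabeling.isArbdefectiveColoring (hl : IsOrientationLabeling G A r m K l)
    (hid : Function.Injective ident) {k s R : ℕ} (hk : 1 ≤ k) (hs : (r + 1) * K ≤ s)
    (hR : A / k + m ≤ R) :
    IsArbdefectiveColoring G R k ((simpleArbdefective k s).run G ident
      (fun v => (parentSet G l v).image ident)) := by
  classical
  have hspec := hl.simpleArbdefective_spec hid hk hs
  refine ⟨fun v => (hspec v).1, fun i => ?_⟩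
  set φ := (simpleArbdefective k s).run G ident (fun v => (parentSet G l v).image ident)
  -- The identity number breaks ties between equal labels, which orients the remaining edges without
  -- creating a directed cycle.
  refine arboricityAtMost_of_key (κ := ℕ ×ₗ ℕ ×ₗ ℕ) _ _
    (fun v => toLex ((l v).1, toLex ((l v).2, ident v))) (fun v w ha e => ?_) fun v => ?_
  · have h1 : ident v = ident w := by
      simp only [EmbeddingLike.apply_eq_iff_eq, Prod.mk.injEq] at e
      exact e.2.2
    exact ha.ne (Subtype.ext (hid h1))
  · refine le_trans ?_ ((add_le_add (hspec v).2 (hl.card_unoriented_le v)).trans hR)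
    rw [← Finset.card_map (Function.Embedding.subtype _)]
    refine (Finset.card_le_card ?_).trans (Finset.card_union_le _ _)
    intro w hw
    obtain ⟨x, hx, rfl⟩ := Finset.mem_map.1 hw
    obtain ⟨hx1, hx2⟩ := Finset.mem_filter.1 hx
    have ha : G.Adj v x := (mem_nbrs.1 hx1 : (G.induce {v | φ v = i}).Adj v x)
    have hφ : φ x = φ v := (x.2 : φ x = i).trans (v.2 : φ v = i).symm
    simp only [Prod.Lex.toLex_lt_toLex] at hx2
    simp only [Finset.mem_union, Finset.mem_filter, parentSet, mem_nbrs,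
      Function.Embedding.subtype_apply, ha, hφ, true_and, and_true]
    rcases hx2 with h | ⟨h, h' | ⟨h', -⟩⟩
    · exact Or.inl (Or.inl h)
    · exact Or.inl (Or.inr ⟨h, h'⟩)
    · exact Or.inr (Prod.ext h.symm h'.symm)

end Orientation

/-! ### Existence of `D`: recoloring by quadratic polynomials -/

/-- A prime number in `(m, 2 m]`, for `m ≥ 1`. -/
noncomputable def bertrandPrime (m : ℕ) : ℕ :=
  if h : m ≠ 0 then (Nat.exists_prime_lt_and_le_two_mul m h).choose else 2

theorem bertrandPrime_spec {m : ℕ} (h : m ≠ 0) :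
    (bertrandPrime m).Prime ∧ m < bertrandPrime m ∧ bertrandPrime m ≤ 2 * m := by
  rw [bertrandPrime, dif_pos h]
  exact (Nat.exists_prime_lt_and_le_two_mul m h).choose_spec

theorem bertrandPrime_prime (m : ℕ) : (bertrandPrime m).Prime := by
  by_cases h : m ≠ 0
  · exact (bertrandPrime_spec h).1
  · rw [bertrandPrime, dif_neg h]
    exact Nat.prime_two

/-- The orders of the prime fields used by the iterated recoloring, in reverse order. -/
noncomputable def fieldOrder (p : ℕ) : ℕ → ℕ
  | 0 => bertrandPrime (16 * p)
  | j + 1 => bertrandPrime (2 * fieldOrder p j)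

theorem fieldOrder_prime (p j : ℕ) : (fieldOrder p j).Prime := by
  cases j <;> exact bertrandPrime_prime _

theorem fieldOrder_succ (p j : ℕ) :
    2 * fieldOrder p j < fieldOrder p (j + 1) ∧ fieldOrder p (j + 1) ≤ 4 * fieldOrder p j := by
  have h := bertrandPrime_spec (m := 2 * fieldOrder p j)
    (by have := (fieldOrder_prime p j).pos; omega)
  exact ⟨h.2.1, h.2.2.trans (by omega)⟩

theorem fieldOrder_gt {p : ℕ} (hp : 1 ≤ p) (j : ℕ) : 16 * p * 2 ^ j < fieldOrder p j := by
  induction j with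
  | zero =>
    rw [pow_zero, mul_one]
    exact (bertrandPrime_spec (m := 16 * p) (by omega)).2.1
  | succ j ih =>
    have := (fieldOrder_succ p j).1
    rw [pow_succ, ← mul_assoc]
    omega

/-- This lets the rounds be chained: the q² colors left by one round fit into the q³ quadratic
polynomials over the next, smaller field. The starting value 16p supplies (4q)² ≤ q³. -/
theorem fieldOrder_succ_sq_le {p : ℕ} (hp : 1 ≤ p) (j : ℕ) :
    fieldOrder p (j + 1) ^ 2 ≤ fieldOrder p j ^ 3 := by
  have h1 := (fieldOrder_succ p j).2
  have h2 : 16 ≤ fieldOrder p j := by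
    have := fieldOrder_gt hp j
    have h3 : 1 ≤ 2 ^ j := Nat.one_le_two_pow
    nlinarith
  calc fieldOrder p (j + 1) ^ 2 ≤ (4 * fieldOrder p j) ^ 2 := Nat.pow_le_pow_left h1 2
    _ = 16 * fieldOrder p j ^ 2 := by ring
    _ ≤ fieldOrder p j * fieldOrder p j ^ 2 := Nat.mul_le_mul_right _ h2
    _ = _ := by ring

/-- The value at `x` of the quadratic polynomial over `ℤ/q` whose coefficients are the three lowest
digits of `c` in base `q`. -/
def digitEval (q c x : ℕ) : ℕ := (c % q + c / q % q * x + c / q ^ 2 % q * x ^ 2) % q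

open Polynomial in
theorem card_digitEval_eq_le {q : ℕ} (hq : q.Prime) {c c' : ℕ} (hc : c < q ^ 3) (hc' : c' < q ^ 3)
    (hne : c ≠ c') :
    ((Finset.range q).filter fun x => digitEval q c x = digitEval q c' x).card ≤ 2 := by
  have := Fact.mk hq
  let P : ℕ → (ZMod q)[X] := fun c => C ((c / q ^ 2 % q : ℕ) : ZMod q) * X ^ 2 +
    C ((c / q % q : ℕ) : ZMod q) * X + C ((c % q : ℕ) : ZMod q)
  have hdeg : (P c - P c').natDegree ≤ 2 :=
    (natDegree_sub_le _ _).trans (max_le natDegree_quadratic_le natDegree_quadratic_le)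
  have hcast : ∀ i j : ℕ, ((i % q : ℕ) : ZMod q) = ((j % q : ℕ) : ZMod q) → i % q = j % q := by
    intro i j h
    rw [ZMod.natCast_eq_natCast_iff', Nat.mod_mod, Nat.mod_mod] at h
    exact h
  have hP : P c - P c' ≠ 0 := by
    intro h
    rw [sub_eq_zero] at h
    apply hne
    have h0 := hcast _ _ (by simpa [P] using congrArg (fun p => coeff p 0) h)
    have h1 := hcast (c / q) (c' / q)
      (by simpa [P, coeff_X, coeff_C] using congrArg (fun p => coeff p 1) h)
    have h2 := hcast (c / q ^ 2) (c' / q ^ 2)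
      (by simpa [P, coeff_X, coeff_C] using congrArg (fun p => coeff p 2) h)
    -- Three digits determine a color below q³, so distinct colors give distinct polynomials.
    have h3 : ∀ c < q ^ 3, c / q ^ 2 % q = c / q ^ 2 := fun c hc =>
      Nat.mod_eq_of_lt (Nat.div_lt_of_lt_mul (by rw [← pow_succ]; exact hc))
    rw [h3 c hc, h3 c' hc', pow_two, ← Nat.div_div_eq_div_mul, ← Nat.div_div_eq_div_mul] at h2
    have h4 : c / q = c' / q := by
      rw [← Nat.div_add_mod (c / q) q, ← Nat.div_add_mod (c' / q) q, h1, h2]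
    rw [← Nat.div_add_mod c q, ← Nat.div_add_mod c' q, h0, h4]
  refine le_trans ?_ ((card_roots' (P c - P c')).trans hdeg)
  refine le_trans ?_ (Multiset.toFinset_card_le _)
  refine Finset.card_le_card_of_injOn (fun x => (x : ZMod q)) ?_ ?_
  · intro x hx
    have hx := (Finset.mem_filter.1 hx).2
    have h : ((c % q + c / q % q * x + c / q ^ 2 % q * x ^ 2 : ℕ) : ZMod q) =
        ((c' % q + c' / q % q * x + c' / q ^ 2 % q * x ^ 2 : ℕ) : ZMod q) := by
      rw [ZMod.natCast_eq_natCast_iff']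
      exact hx
    push_cast at h
    rw [Finset.mem_coe, Multiset.mem_toFinset, mem_roots hP, IsRoot.def, eval_sub, sub_eq_zero]
    simp only [P, eval_add, eval_mul, eval_C, eval_pow, eval_X]
    linear_combination h
  · intro x hx y hy h
    have hx := Finset.mem_range.1 (Finset.mem_filter.1 hx).1
    have hy := Finset.mem_range.1 (Finset.mem_filter.1 hy).1
    have h : (x : ZMod q) = y := h
    rw [ZMod.natCast_eq_natCast_iff', Nat.mod_eq_of_lt hx, Nat.mod_eq_of_lt hy] at h
    exact h

/-- The number of the neighbours of another color whose polynomial agrees at `x` with that of `c`. -/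
def conflicts (q c : ℕ) (cs : Multiset ℕ) (x : ℕ) : ℕ :=
  cs.countP fun c' => c' ≠ c ∧ digitEval q c' x = digitEval q c x

/-- Distinct quadratics agree in at most two points, so each neighbor contributes at most 2 to the
sum; a best point then has at most the average, 2Δ/q. -/
theorem sum_conflicts_le {q : ℕ} (hq : q.Prime) {c : ℕ} (hc : c < q ^ 3) (cs : Multiset ℕ)
    (hcs : ∀ c' ∈ cs, c' < q ^ 3) : ∑ x ∈ Finset.range q, conflicts q c cs x ≤ 2 * cs.card := by
  induction cs using Multiset.induction with
  | empty => simp [conflicts]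
  | cons a s ih =>
    have h1 := ih fun c' h => hcs c' (Multiset.mem_cons_of_mem h)
    simp only [conflicts] at h1 ⊢
    simp only [Multiset.countP_cons, Finset.sum_add_distrib, Multiset.card_cons]
    have h2 : (∑ x ∈ Finset.range q,
        if a ≠ c ∧ digitEval q a x = digitEval q c x then 1 else 0) ≤ 2 := by
      rw [← Finset.card_filter]
      by_cases hac : a = c
      · simp [hac]
      · simp only [ne_eq, hac, not_false_eq_true, true_and]
        exact card_digitEval_eq_le hq (hcs a (Multiset.mem_cons_self a s)) hc hac
    omega

open Classical in
/-- A point of `ℤ/q` with the minimum number of conflicts. -/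
noncomputable def bestPoint (q c : ℕ) (cs : Multiset ℕ) : ℕ :=
  if h : ∃ x ∈ Finset.range q, ∀ y ∈ Finset.range q, conflicts q c cs x ≤ conflicts q c cs y
  then h.choose else 0

theorem bestPoint_spec {q : ℕ} (hq : q.Prime) {c : ℕ} (hc : c < q ^ 3) (cs : Multiset ℕ)
    (hcs : ∀ c' ∈ cs, c' < q ^ 3) :
    bestPoint q c cs < q ∧ q * conflicts q c cs (bestPoint q c cs) ≤ 2 * cs.card := by
  have h := (Finset.range q).exists_min_image (conflicts q c cs)
    ⟨0, Finset.mem_range.2 hq.pos⟩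
  have h' := h.choose_spec
  rw [bestPoint, dif_pos h]
  refine ⟨Finset.mem_range.1 h'.1, ?_⟩
  refine le_trans ?_ (sum_conflicts_le hq hc cs hcs)
  calc _ = ∑ _y ∈ Finset.range q, conflicts q c cs h.choose := by simp
    _ ≤ _ := Finset.sum_le_sum fun y hy => h'.2 y hy

/-- One recoloring step: from `q³` colors to `q²` colors. -/
noncomputable def recolor (q c : ℕ) (cs : Multiset ℕ) : ℕ :=
  bestPoint q c cs * q + digitEval q c (bestPoint q c cs)

/-- A defective coloring procedure: iterated recoloring by quadratic polynomials over prime fields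
of decreasing orders. -/
noncomputable def iteratedRecoloring (p J : ℕ) : LocalAlg Unit ℕ where
  State := ℕ × ℕ
  Msg := ℕ
  rounds := J
  init := fun x _ => (0, x - 1)
  send := fun st => st.2
  recv := fun st ms => (st.1 + 1, recolor (fieldOrder p (J - 1 - st.1)) st.2 ms)
  out := fun st => st.2 + 1

section

variable {V : Type u} [Fintype V] (G : SimpleGraph V) (ident : V → ℕ) (p J : ℕ)

/-- The color after `t` steps of the iterated recoloring. -/
noncomputable def recolorAt (t : ℕ) (v : V) : ℕ :=
  ((iteratedRecoloring p J).stateAt G ident (fun _ => ()) t v).2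

theorem recolorAt_succ (t : ℕ) (v : V) : recolorAt G ident p J (t + 1) v =
    recolor (fieldOrder p (J - 1 - t)) (recolorAt G ident p J t v)
      ((nbrs G v).val.map (recolorAt G ident p J t)) := by
  have h : ∀ t v, ((iteratedRecoloring p J).stateAt G ident (fun _ => ()) t v).1 = t := by
    intro t
    induction t with
    | zero => intro v; rfl
    | succ t ih => intro v; exact congrArg (· + 1) (ih v)
  change recolor (fieldOrder p (J - 1 -
    ((iteratedRecoloring p J).stateAt G ident (fun _ => ()) t v).1)) _ _ = _
  rw [h]
  rfl

variable {G ident p J} {Δ : ℕ}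

theorem recolor_lt {q : ℕ} (hq : q.Prime) {c : ℕ} (hc : c < q ^ 3) (cs : Multiset ℕ)
    (hcs : ∀ c' ∈ cs, c' < q ^ 3) : recolor q c cs < q ^ 2 := by
  have h1 := (bestPoint_spec hq hc cs hcs).1
  have h2 : digitEval q c (bestPoint q c cs) < q := Nat.mod_lt _ hq.pos
  rw [recolor]
  nlinarith

/-- In a recoloring step the defect grows by at most `2 Δ / q`. -/
theorem recolor_defect {q : ℕ} (hq : q.Prime) (col : V → ℕ) (hcol : ∀ v, col v < q ^ 3) (v : V) :
    ∃ e, q * e ≤ 2 * (nbrs G v).card ∧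
      ((nbrs G v).filter fun w => recolor q (col w) ((nbrs G w).val.map col) =
        recolor q (col v) ((nbrs G v).val.map col)).card ≤
      ((nbrs G v).filter fun w => col w = col v).card + e := by
  classical
  have hb : ∀ v, _ := fun v => bestPoint_spec hq (hcol v) ((nbrs G v).val.map col) fun c' h => by
    obtain ⟨w, -, rfl⟩ := Multiset.mem_map.1 h
    exact hcol w
  refine ⟨conflicts q (col v) ((nbrs G v).val.map col)
    (bestPoint q (col v) ((nbrs G v).val.map col)), ?_, ?_⟩
  · simpa using (hb v).2
  · have hconf : conflicts q (col v) ((nbrs G v).val.map col)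
        (bestPoint q (col v) ((nbrs G v).val.map col)) =
        ((nbrs G v).filter fun w => col w ≠ col v ∧
          digitEval q (col w) (bestPoint q (col v) ((nbrs G v).val.map col)) =
          digitEval q (col v) (bestPoint q (col v) ((nbrs G v).val.map col))).card := by
      rw [conflicts, Multiset.countP_map, Finset.card_def, Finset.filter_val]
    rw [hconf]
    refine (Finset.card_le_card ?_).trans (Finset.card_union_le _ _)
    intro w hw
    obtain ⟨h1, h2⟩ := Finset.mem_filter.1 hw
    rw [Finset.mem_union, Finset.mem_filter, Finset.mem_filter]
    by_cases he : col w = col v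
    · exact Or.inl ⟨h1, he⟩
    · refine Or.inr ⟨h1, he, ?_⟩
      -- A new color determines its point and value by division with remainder, so `w` agrees with
      -- `v` at the very point chosen by `v`.
      have hlt : ∀ c x, digitEval q c x < q := fun c x => Nat.mod_lt _ hq.pos
      have hx := congrArg (· / q) h2
      have hy := congrArg (· % q) h2
      simp only [recolor, mul_comm _ q, Nat.mul_add_div hq.pos,
        Nat.div_eq_of_lt (hlt _ _), add_zero, Nat.mul_add_mod, Nat.mod_eq_of_lt (hlt _ _)] at hx hy
      rwa [hx] at hy

theorem recolorAt_spec (hp : 1 ≤ p) {n : ℕ} (hJ : n ≤ 2 ^ J) (hid : IsIdentification n ident)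
    (hΔ : ∀ v, (nbrs G v).card ≤ Δ) (t : ℕ) (ht : t ≤ J) :
    (∀ v, recolorAt G ident p J t v < fieldOrder p (J - t) ^ 2) ∧
    ∀ v, fieldOrder p (J - t) *
      ((nbrs G v).filter fun w => recolorAt G ident p J t w = recolorAt G ident p J t v).card ≤
        4 * Δ := by
  induction t with
  | zero =>
    have h0 : ∀ v, recolorAt G ident p J 0 v = ident v - 1 := fun v => rfl
    refine ⟨fun v => ?_, fun v => ?_⟩
    · rw [h0]
      have h1 := (hid.2 v)
      have h2 := fieldOrder_gt hp J
      have h3 : 2 ^ J ≤ 16 * p * 2 ^ J := Nat.le_mul_of_pos_left _ (by omega)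
      have h4 : fieldOrder p J ≤ fieldOrder p J ^ 2 := Nat.le_self_pow (by norm_num) _
      rw [Nat.sub_zero]
      omega
    · rw [Finset.card_eq_zero.2, mul_zero]
      · exact Nat.zero_le _
      · refine Finset.filter_eq_empty_iff.2 fun w hw e => ?_
        rw [h0, h0] at e
        have h1 := hid.2 v
        have h2 := hid.2 w
        exact (mem_nbrs.1 hw).ne (hid.1 (by omega))
  | succ t ih =>
    obtain ⟨ih1, ih2⟩ := ih (by omega)
    obtain ⟨j, hj⟩ : ∃ j, J = t + 1 + j := ⟨J - (t + 1), by omega⟩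
    have e1 : J - t = j + 1 := by omega
    have e2 : J - (t + 1) = j := by omega
    have e3 : J - 1 - t = j := by omega
    rw [e1] at ih1 ih2
    rw [e2]
    have hq := fieldOrder_prime p j
    have hlt : ∀ v, recolorAt G ident p J t v < fieldOrder p j ^ 3 := fun v =>
      (ih1 v).trans_le (fieldOrder_succ_sq_le hp j)
    simp only [recolorAt_succ, e3]
    refine ⟨fun v => recolor_lt hq (hlt v) _ fun c' h => ?_, fun v => ?_⟩
    · obtain ⟨w, -, rfl⟩ := Multiset.mem_map.1 h
      exact hlt w
    -- With d the old defect and q, q' the new and old orders, q' > 2q turns q'd ≤ 4Δ into qd ≤ 2Δ.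
    -- The new conflicts satisfy qe ≤ 2Δ, which restores 4Δ.
    · obtain ⟨e, he, hd⟩ := recolor_defect (G := G) hq (recolorAt G ident p J t) hlt v
      have h1 := ih2 v
      have h2 := (fieldOrder_succ p j).1
      have h3 := hΔ v
      have h4 := Nat.mul_le_mul_left (fieldOrder p j) hd
      have h5 := Nat.mul_le_mul_right ((nbrs G v).filter fun w =>
        recolorAt G ident p J t w = recolorAt G ident p J t v).card h2.le
      rw [mul_add] at h4
      rw [mul_assoc] at h5
      omega

end

theorem exists_isDefectiveColoringProcedure :
    ∃ D : ℕ → ℕ → ℕ → LocalAlg Unit ℕ, IsDefectiveColoringProcedure.{u} D := by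
  -- The last field order lies in (16p, 32p], whence (32p)² = 1024p² colors and, from 16pd ≤ 4Δ, a
  -- defect below Δ/p.
  refine ⟨fun n _ p => iteratedRecoloring p (Nat.log 2 n + 1), 1024, fun n Δ p hn hp => ⟨?_, ?_⟩⟩
  · have h1 := log_add_one_le_two_mul_logb hn
    have h2 := one_le_logb_two hn
    change ((Nat.log 2 n + 1 : ℕ) : ℝ) ≤ _
    push_cast at h1 ⊢
    linarith
  · intro V _ G ident hid hdeg
    have hs := recolorAt_spec (G := G) hp (J := Nat.log 2 n + 1)
      (Nat.lt_pow_succ_log_self (by norm_num) n).le hid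
      (fun v => by rw [← ncard_neighborSet_eq]; exact hdeg v) (Nat.log 2 n + 1) le_rfl
    rw [Nat.sub_self] at hs
    have hrun : ∀ v, (iteratedRecoloring p (Nat.log 2 n + 1)).run G ident (fun _ => ()) v =
        recolorAt G ident p (Nat.log 2 n + 1) (Nat.log 2 n + 1) v + 1 := fun v => rfl
    have hq := (bertrandPrime_spec (m := 16 * p) (by omega))
    have hq0 : fieldOrder p 0 = bertrandPrime (16 * p) := rfl
    refine ⟨fun v => ?_, fun v => ?_⟩
    · rw [hrun]
      have h1 := hs.1 v
      have h2 : fieldOrder p 0 ^ 2 ≤ (32 * p) ^ 2 := Nat.pow_le_pow_left (by omega) 2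
      rw [mul_pow] at h2
      omega
    · rw [ncard_neighbors_eq, Nat.le_div_iff_mul_le hp]
      simp only [hrun, Nat.add_right_cancel_iff]
      have h1 := hs.2 v
      rw [hq0] at h1
      have h2 := Nat.mul_le_mul_right ((nbrs G v).filter fun w =>
        recolorAt G ident p (Nat.log 2 n + 1) (Nat.log 2 n + 1) w =
        recolorAt G ident p (Nat.log 2 n + 1) (Nat.log 2 n + 1) v).card hq.2.1.le
      rw [mul_assoc] at h2
      rw [mul_comm]
      omega

/-! ### Additive color reduction -/

/-- Color reduction from `q²` to `q` colors in `q` rounds, for a prime `q` greater than twice the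
maximum degree: a color is a pair `(a, b)`; a vertex with a neighbour of the same second component
moves to `(a, a + b)`, and to `(0, b)` otherwise. -/
def additiveReduction (q : ℕ) : LocalAlg ℕ ℕ where
  State := ℕ × ℕ
  Msg := ℕ
  rounds := q
  init := fun _ c => ((c - 1) / q, (c - 1) % q)
  send := fun st => st.2
  recv := fun st ms => if st.2 ∈ ms then (st.1, (st.1 + st.2) % q) else (0, st.2)
  out := fun st => st.2 + 1

section

variable {V : Type u} [Fintype V] (G : SimpleGraph V) (ident : V → ℕ) (q : ℕ) (col : V → ℕ)

/-- The pair held by a vertex after `t` rounds. -/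
noncomputable def pairAt (t : ℕ) (v : V) : ℕ × ℕ :=
  (additiveReduction q).stateAt G ident col t v

theorem pairAt_succ (t : ℕ) (v : V) : pairAt G ident q col (t + 1) v =
    if (pairAt G ident q col t v).2 ∈ (nbrs G v).val.map (fun w => (pairAt G ident q col t w).2)
    then ((pairAt G ident q col t v).1,
      ((pairAt G ident q col t v).1 + (pairAt G ident q col t v).2) % q)
    else (0, (pairAt G ident q col t v).2) := rfl

variable {G ident q col}

theorem pairAt_cases (t : ℕ) (v : V) :
    ((∃ w, G.Adj v w ∧ (pairAt G ident q col t w).2 = (pairAt G ident q col t v).2) ∧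
      pairAt G ident q col (t + 1) v = ((pairAt G ident q col t v).1,
        ((pairAt G ident q col t v).1 + (pairAt G ident q col t v).2) % q)) ∨
    ((∀ w, G.Adj v w → (pairAt G ident q col t w).2 ≠ (pairAt G ident q col t v).2) ∧
      pairAt G ident q col (t + 1) v = (0, (pairAt G ident q col t v).2)) := by
  by_cases h : (pairAt G ident q col t v).2 ∈
      (nbrs G v).val.map (fun w => (pairAt G ident q col t w).2)
  · refine Or.inl ⟨?_, by rw [pairAt_succ, if_pos h]⟩
    obtain ⟨w, hw, e⟩ := Multiset.mem_map.1 h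
    exact ⟨w, mem_nbrs.1 hw, e⟩
  · refine Or.inr ⟨fun w hw e => h (Multiset.mem_map.2 ⟨w, mem_nbrs.2 hw, e⟩), ?_⟩
    rw [pairAt_succ, if_neg h]

theorem pairAt_lt (hq : q.Prime) (hcol : ∀ v, 1 ≤ col v ∧ col v ≤ q ^ 2) (t : ℕ) (v : V) :
    (pairAt G ident q col t v).1 < q ∧ (pairAt G ident q col t v).2 < q := by
  induction t generalizing v with
  | zero =>
    have h := hcol v
    rw [pow_two] at h
    exact ⟨Nat.div_lt_of_lt_mul (by omega), Nat.mod_lt _ hq.pos⟩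
  | succ t ih =>
    rcases pairAt_cases (G := G) (ident := ident) (q := q) (col := col) t v with ⟨-, h⟩ | ⟨-, h⟩
    · rw [h]
      exact ⟨(ih v).1, Nat.mod_lt _ hq.pos⟩
    · rw [h]
      exact ⟨hq.pos, (ih v).2⟩

/-- If both endpoints move, equal results force equal pairs before. If one moves and one becomes
final, equal results force first component 0, so the move was trivial and the other endpoint had a
conflict after all. -/
theorem pairAt_ne (hq : q.Prime) (hcol : ∀ v, 1 ≤ col v ∧ col v ≤ q ^ 2)
    (hne : ∀ v w, G.Adj v w → col v ≠ col w) (t : ℕ) (v w : V) (ha : G.Adj v w) :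
    pairAt G ident q col t v ≠ pairAt G ident q col t w := by
  induction t with
  | zero =>
    intro e
    have h0 : ∀ v, pairAt G ident q col 0 v = ((col v - 1) / q, (col v - 1) % q) := fun _ => rfl
    rw [h0, h0, Prod.mk.injEq] at e
    have h1 : col v - 1 = col w - 1 := by
      rw [← Nat.div_add_mod (col v - 1) q, ← Nat.div_add_mod (col w - 1) q, e.1, e.2]
    have h2 := hcol v
    have h3 := hcol w
    exact hne v w ha (by omega)
  | succ t ih =>
    intro e
    have hv := pairAt_lt (G := G) (ident := ident) hq hcol t v
    have hw := pairAt_lt (G := G) (ident := ident) hq hcol t w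
    rcases pairAt_cases (G := G) (ident := ident) (q := q) (col := col) t v with
      ⟨-, h⟩ | ⟨h1, h⟩ <;>
    rcases pairAt_cases (G := G) (ident := ident) (q := q) (col := col) t w with
      ⟨-, h'⟩ | ⟨h2, h'⟩ <;>
    rw [h, h', Prod.mk.injEq] at e
    · obtain ⟨e1, e2⟩ := e
      rw [e1] at e2
      have e3 := Nat.ModEq.add_left_cancel' _ (show _ ≡ _ [MOD q] from e2)
      exact ih (Prod.ext e1 (Nat.ModEq.eq_of_lt_of_lt e3 hv.2 hw.2))
    · obtain ⟨e1, e2⟩ := e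
      rw [e1, zero_add, Nat.mod_eq_of_lt hv.2] at e2
      exact h2 v ha.symm e2
    · obtain ⟨e1, e2⟩ := e
      rw [← e1, zero_add, Nat.mod_eq_of_lt hw.2] at e2
      exact h1 w ha e2.symm
    · exact h1 w ha e.2.symm

theorem pairAt_fst_ne_zero {t t' : ℕ} (htt : t ≤ t') {v : V}
    (h : (pairAt G ident q col t' v).1 ≠ 0) : (pairAt G ident q col t v).1 ≠ 0 := by
  induction t', htt using Nat.le_induction with
  | base => exact h
  | succ s hs ih =>
    apply ih
    rcases pairAt_cases (G := G) (ident := ident) (q := q) (col := col) s v with ⟨-, e⟩ | ⟨-, e⟩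
    · rwa [e] at h
    · rw [e] at h
      exact absurd rfl h

/-- As long as the first component is nonzero, the second one moves linearly. -/
theorem pairAt_linear {t d : ℕ} {v : V} (h : (pairAt G ident q col (t + d) v).1 ≠ 0) :
    (pairAt G ident q col (t + d) v).1 = (pairAt G ident q col t v).1 ∧
    ((pairAt G ident q col (t + d) v).2 : ZMod q) =
      (pairAt G ident q col t v).2 + d * (pairAt G ident q col t v).1 := by
  induction d with
  | zero => simp
  | succ d ih =>
    have h1 := ih (pairAt_fst_ne_zero (by omega) h)
    rw [← add_assoc] at h ⊢
    rcases pairAt_cases (G := G) (ident := ident) (q := q) (col := col) (t + d) v with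
      ⟨-, e⟩ | ⟨-, e⟩
    · rw [e]
      refine ⟨h1.1, ?_⟩
      simp only [ZMod.natCast_mod, Nat.cast_add]
      rw [h1.2, h1.1]
      push_cast
      ring
    · rw [e] at h
      exact absurd rfl h

theorem pairAt_const (hq : q.Prime) (hcol : ∀ v, 1 ≤ col v ∧ col v ≤ q ^ 2) {t d : ℕ} {v : V}
    (h : (pairAt G ident q col t v).1 = 0) :
    (pairAt G ident q col (t + d) v).1 = 0 ∧
    (pairAt G ident q col (t + d) v).2 = (pairAt G ident q col t v).2 := by
  induction d with
  | zero => exact ⟨h, rfl⟩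
  | succ d ih =>
    rw [← add_assoc]
    have hv := pairAt_lt (G := G) (ident := ident) hq hcol (t + d) v
    rcases pairAt_cases (G := G) (ident := ident) (q := q) (col := col) (t + d) v with
      ⟨-, e⟩ | ⟨-, e⟩
    · rw [e, ih.1]
      refine ⟨rfl, ?_⟩
      simp only
      rw [zero_add, Nat.mod_eq_of_lt hv.2, ih.2]
    · rw [e]
      exact ⟨rfl, ih.2⟩

/-- While a vertex has not become final, each neighbour disturbs it at most twice. -/
theorem card_disturbed_le (hq : q.Prime) (hcol : ∀ v, 1 ≤ col v ∧ col v ≤ q ^ 2)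
    (hne : ∀ v w, G.Adj v w → col v ≠ col w) {v w : V} (ha : G.Adj v w)
    (hv : (pairAt G ident q col q v).1 ≠ 0) :
    ((Finset.range q).filter fun t =>
      (pairAt G ident q col t w).2 = (pairAt G ident q col t v).2).card ≤ 2 := by
  have := Fact.mk hq
  have hzero : ∀ d < q, ((d : ℕ) : ZMod q) = 0 → d = 0 := fun d hd h =>
    Nat.eq_zero_of_dvd_of_lt ((ZMod.natCast_eq_zero_iff d q).1 h) hd
  have hinj : ∀ x y : ℕ, x < q → y < q → (x : ZMod q) = y → x = y := by
    intro x y hx hy h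
    rwa [ZMod.natCast_eq_natCast_iff', Nat.mod_eq_of_lt hx, Nat.mod_eq_of_lt hy] at h
  have hlt := fun t v => pairAt_lt (G := G) (ident := ident) hq hcol t v
  -- Split the rounds by whether `w` is final. In each phase both second components are linear in
  -- time with different slopes (equal slopes would make the pairs coincide), so they meet at most
  -- once modulo q.
  rw [← Finset.card_filter_add_card_filter_not (p := fun t => (pairAt G ident q col t w).1 = 0)]
  have key : ∀ T : Finset ℕ, (∀ t d, t ∈ T → t + d ∈ T → d = 0) → T.card ≤ 1 := by
    intro T hT
    refine Finset.card_le_one.2 fun x hx y hy => ?_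
    rcases le_total x y with h | h
    · obtain ⟨d, rfl⟩ := Nat.exists_eq_add_of_le h
      rw [hT x d hx hy, add_zero]
    · obtain ⟨d, rfl⟩ := Nat.exists_eq_add_of_le h
      rw [hT y d hy hx, add_zero]
  refine add_le_add (b := 1) (d := 1) (key _ ?_) (key _ ?_)
  all_goals
    intro t d h1 h2
    rw [Finset.mem_filter, Finset.mem_filter, Finset.mem_range] at h1 h2
    obtain ⟨⟨-, h1⟩, h1'⟩ := h1
    obtain ⟨⟨hd, h2⟩, h2'⟩ := h2
    have hv' := pairAt_fst_ne_zero hd.le hv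
    have lv := pairAt_linear hv'
    rw [lv.1] at hv'
  · have lw := (pairAt_const (d := d) hq hcol h1').2
    rw [← h2, lw, h1] at lv
    have h3 : (d : ZMod q) * (pairAt G ident q col t v).1 = 0 := by
      linear_combination -lv.2
    rcases mul_eq_zero.1 h3 with h | h
    · exact hzero d (by omega) h
    · exact absurd (hzero _ (hlt t v).1 h) hv'
  · have lw := pairAt_linear h2'
    rw [h2] at lw
    rw [h1] at lw
    have h3 : (d : ZMod q) * ((pairAt G ident q col t v).1 - (pairAt G ident q col t w).1) = 0 := by
      linear_combination lw.2 - lv.2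
    rcases mul_eq_zero.1 h3 with h | h
    · exact hzero d (by omega) h
    · exact absurd (Prod.ext (hinj _ _ (hlt t v).1 (hlt t w).1 (sub_eq_zero.1 h)) h1.symm)
        (pairAt_ne hq hcol hne t v w ha)

/-- A vertex not final after q rounds was disturbed in every one of them, but its neighbors account
for at most twice its degree. -/
theorem pairAt_final (hq : q.Prime) (hcol : ∀ v, 1 ≤ col v ∧ col v ≤ q ^ 2)
    (hne : ∀ v w, G.Adj v w → col v ≠ col w) (v : V) (hdeg : 2 * (nbrs G v).card < q) :
    (pairAt G ident q col q v).1 = 0 := by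
  classical
  by_contra hv
  have hsub : Finset.range q ⊆ (nbrs G v).biUnion fun w => (Finset.range q).filter fun t =>
      (pairAt G ident q col t w).2 = (pairAt G ident q col t v).2 := by
    intro t ht
    rw [Finset.mem_biUnion]
    rcases pairAt_cases (G := G) (ident := ident) (q := q) (col := col) t v with
      ⟨⟨w, hw, e⟩, -⟩ | ⟨-, e⟩
    · exact ⟨w, mem_nbrs.2 hw, Finset.mem_filter.2 ⟨ht, e⟩⟩
    · have h := pairAt_fst_ne_zero (Nat.succ_le_of_lt (Finset.mem_range.1 ht)) hv
      rw [Nat.succ_eq_add_one, e] at h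
      exact absurd rfl h
  have h1 := Finset.card_le_card hsub
  have h2 := h1.trans (Finset.card_biUnion_le_card_mul _ _ 2 fun w hw =>
    card_disturbed_le hq hcol hne (mem_nbrs.1 hw) hv)
  rw [Finset.card_range] at h2
  omega

theorem isDefectiveColoring_additiveReduction (hq : q.Prime)
    (hcol : IsDefectiveColoring G 0 (q ^ 2) col) (hdeg : ∀ v, 2 * (nbrs G v).card < q) :
    IsDefectiveColoring G 0 q ((additiveReduction q).run G ident col) := by
  have hrun : ∀ v, (additiveReduction q).run G ident col v = (pairAt G ident q col q v).2 + 1 :=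
    fun v => rfl
  have hne : ∀ v w, G.Adj v w → col v ≠ col w := by
    intro v w ha e
    have h := hcol.2 v
    rw [ncard_neighbors_eq, Nat.le_zero, Finset.card_eq_zero] at h
    exact Finset.notMem_empty w (h ▸ Finset.mem_filter.2 ⟨mem_nbrs.2 ha, e.symm⟩)
  refine ⟨fun v => ?_, fun v => ?_⟩
  · rw [hrun]
    have := (pairAt_lt (G := G) (ident := ident) hq hcol.1 q v).2
    omega
  · rw [ncard_neighbors_eq, Nat.le_zero, Finset.card_eq_zero, Finset.filter_eq_empty_iff]
    intro w hw e
    rw [hrun, hrun, Nat.add_right_cancel_iff] at e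
    refine pairAt_ne (ident := ident) hq hcol.1 hne q v w (mem_nbrs.1 hw) (Prod.ext ?_ e.symm)
    rw [pairAt_final hq hcol.1 hne v (hdeg v), pairAt_final hq hcol.1 hne w (hdeg w)]

end

/-! ### Existence of `L` -/

theorem exists_isLegalColoringProcedure (ε : ℝ) (hε : 0 < ε) :
    ∃ L : ℕ → ℕ → LocalAlg Unit ℕ, IsLegalColoringProcedure.{u} ε L := by
  obtain ⟨D, c, hD⟩ := exists_isDefectiveColoringProcedure.{u}
  obtain ⟨c₁, hc₁⟩ := exists_hPartition_rounds.{u} ε hε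
  let A : ℕ → ℕ := fun b => ⌊(2 + ε) * b⌋₊
  -- Large enough that q² covers the c(A+1)² colors of `D` and that q exceeds twice the degree, yet
  -- O(b). Using p = A + 1 makes the defect A / (A + 1) = 0. Without the reduction to q colors, the
  -- greedy step would take O(b² log n) rounds.
  let q : ℕ → ℕ := fun b => bertrandPrime (2 * (c + 1) * (A b + 1))
  let r : ℕ → ℕ := fun n => c₁ * (Nat.log 2 n + 1)
  refine ⟨fun n b => (partialOrientation (A b) (r n)
    ((D n (A b) (A b + 1)).seq (additiveReduction (q b)))).seq
      (simpleArbdefective (A b + 1) ((r n + 1) * q b)),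
    2 * c₁ + c + 1 + (2 * c₁ + 2) * (4 * (c + 1) * (⌈ε⌉₊ + 3)), fun n b hn hb => ?_⟩
  have hqs := bertrandPrime_spec (m := 2 * (c + 1) * (A b + 1)) (by positivity)
  obtain ⟨hDr, hDs⟩ := hD n (A b) (A b + 1) hn (by omega)
  refine ⟨?_, ?_⟩
  · change ((r n + ((D n (A b) (A b + 1)).rounds + q b + 1) + (r n + 1) * q b : ℕ) : ℝ) ≤ _
    have hl := one_le_logb_two hn
    have hl2 := log_add_one_le_two_mul_logb hn
    set ℓ := Real.logb 2 n
    have hb' : (1 : ℝ) ≤ b := by exact_mod_cast hb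
    have hr : (r n : ℝ) ≤ c₁ * (2 * ℓ) := by
      change ((c₁ * (Nat.log 2 n + 1) : ℕ) : ℝ) ≤ _
      rw [Nat.cast_mul]
      exact mul_le_mul_of_nonneg_left hl2 (Nat.cast_nonneg _)
    have hA : (A b : ℝ) + 1 ≤ (⌈ε⌉₊ + 3) * b := by
      have h1 : (A b : ℝ) ≤ (2 + ε) * b := Nat.floor_le (by positivity)
      have h2 : ε * b ≤ ⌈ε⌉₊ * b := mul_le_mul_of_nonneg_right (Nat.le_ceil ε) (by positivity)
      linarith
    have hq : (q b : ℝ) ≤ 4 * (c + 1) * (⌈ε⌉₊ + 3) * b := by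
      have h1 : (q b : ℝ) ≤ ((2 * (2 * (c + 1) * (A b + 1)) : ℕ) : ℝ) := by exact_mod_cast hqs.2.2
      push_cast at h1
      calc (q b : ℝ) ≤ 4 * (c + 1) * (A b + 1) := by linarith
        _ ≤ 4 * (c + 1) * ((⌈ε⌉₊ + 3) * b) := mul_le_mul_of_nonneg_left hA (by positivity)
        _ = _ := by ring
    set Q : ℝ := 4 * (c + 1) * (⌈ε⌉₊ + 3)
    have hℓ : ℓ ≤ b * ℓ := le_mul_of_one_le_left (by linarith) hb'
    have hqℓ : (q b : ℝ) * ((2 * c₁ + 2) * ℓ) ≤ Q * b * ((2 * c₁ + 2) * ℓ) :=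
      mul_le_mul_of_nonneg_right hq (by positivity)
    push_cast
    calc (r n + ((D n (A b) (A b + 1)).rounds + q b + 1) + (r n + 1) * q b : ℝ)
        = r n + (D n (A b) (A b + 1)).rounds + 1 + q b * (r n + 2) := by ring
      _ ≤ c₁ * (2 * ℓ) + c * ℓ + ℓ + q b * (c₁ * (2 * ℓ) + 2 * ℓ) := by gcongr; linarith
      _ = (2 * c₁ + c + 1) * ℓ + q b * ((2 * c₁ + 2) * ℓ) := by ring
      _ ≤ (2 * c₁ + c + 1) * (b * ℓ) + Q * b * ((2 * c₁ + 2) * ℓ) := by gcongr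
      _ = _ := by ring
  · intro V _ G ident hid hG
    obtain ⟨l, hl, hrun⟩ := partialOrientation_spec (G := G) (A := A b) (r := r n) (m := 0)
      (K := q b) (D := (D n (A b) (A b + 1)).seq (additiveReduction (q b)))
      (fun W _ G' ident' hid' hdeg => by
        have h := hDs W G' ident' hid' hdeg
        rw [Nat.div_eq_of_lt (Nat.lt_succ_self _)] at h
        rw [LocalAlg.run_seq]
        refine isDefectiveColoring_additiveReduction hqs.1 ⟨fun v => ⟨(h.1 v).1, ?_⟩, h.2⟩
          fun v => ?_
        · refine (h.1 v).2.trans ?_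
          have h1 : (c + 1) * (A b + 1) ≤ q b := by
            refine le_trans (Nat.mul_le_mul_right _ ?_) hqs.2.1.le
            omega
          calc c * (A b + 1) ^ 2 ≤ (c + 1) ^ 2 * (A b + 1) ^ 2 :=
              Nat.mul_le_mul_right _ (by nlinarith)
            _ = ((c + 1) * (A b + 1)) ^ 2 := (mul_pow _ _ _).symm
            _ ≤ _ := Nat.pow_le_pow_left h1 2
        · have h1 := hdeg v
          rw [ncard_neighborSet_eq] at h1
          have h2 : 2 * (A b + 1) ≤ 2 * (c + 1) * (A b + 1) :=
            Nat.mul_le_mul_right _ (by omega)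
          have h3 := hqs.2.1
          change _ < q b at h3
          omega) hid (hc₁ n b hb V G ident hid.card_le hG)
    rw [LocalAlg.run_seq, hrun]
    exact hl.isLegalColoring hid.1 le_rfl

/-! ### Numerical estimates -/

theorem one_le_numParts {a : ℕ} (ha : 1 ≤ a) : 1 ≤ numParts a :=
  Nat.one_le_iff_ne_zero.2 (Nat.ceil_pos.2 (by positivity)).ne'

theorem one_le_rpow_of_one_le {a : ℕ} (ha : 1 ≤ a) {z : ℝ} (hz : 0 ≤ z) : 1 ≤ (a : ℝ) ^ z :=
  Real.one_le_rpow (by exact_mod_cast ha) hz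

theorem numParts_le {a : ℕ} (ha : 1 ≤ a) : (numParts a : ℝ) ≤ 2 * (a : ℝ) ^ (1 / 3 : ℝ) := by
  have h1 := Nat.ceil_lt_add_one (show (0 : ℝ) ≤ (a : ℝ) ^ (1 / 3 : ℝ) by positivity)
  have h2 := one_le_rpow_of_one_le ha (z := 1 / 3) (by norm_num)
  rw [numParts]
  linarith

theorem cube_root_mul (a : ℕ) : (a : ℝ) ^ (1 / 3 : ℝ) * (a : ℝ) ^ (2 / 3 : ℝ) = a := by
  rw [← Real.rpow_add_of_nonneg (Nat.cast_nonneg a) (by norm_num) (by norm_num)]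
  norm_num

theorem numParts_sq_le {a : ℕ} (ha : 1 ≤ a) :
    (numParts a : ℝ) ^ 2 ≤ 4 * (a : ℝ) ^ (2 / 3 : ℝ) := by
  calc (numParts a : ℝ) ^ 2 ≤ (2 * (a : ℝ) ^ (1 / 3 : ℝ)) ^ 2 :=
      pow_le_pow_left₀ (Nat.cast_nonneg _) (numParts_le ha) 2
    _ = 4 * ((a : ℝ) ^ (1 / 3 : ℝ)) ^ 2 := by ring
    _ = _ := by
      rw [← Real.rpow_mul_natCast (Nat.cast_nonneg a)]
      norm_num

theorem div_numParts_le {a : ℕ} (ha : 1 ≤ a) :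
    (a : ℝ) / numParts a ≤ (a : ℝ) ^ (2 / 3 : ℝ) := by
  have h1 : (1 : ℝ) ≤ numParts a := by exact_mod_cast one_le_numParts ha
  rw [div_le_iff₀ (by linarith)]
  calc (a : ℝ) = (a : ℝ) ^ (2 / 3 : ℝ) * (a : ℝ) ^ (1 / 3 : ℝ) := by
        rw [mul_comm, cube_root_mul]
    _ ≤ _ := mul_le_mul_of_nonneg_left (Nat.le_ceil _) (by positivity)

/-- The parents contribute at most (2+ε)a/k and the unoriented edges at most a/k; finally k ≥
a^{1/3}. -/
theorem arbdefect_le_partArboricity {ε : ℝ} (hε : 0 < ε) {a : ℕ}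
    (ha : 1 ≤ a) : ⌊(2 + ε) * a⌋₊ / numParts a + ⌊(2 + ε) * a⌋₊ / (⌈2 + ε⌉₊ * numParts a) ≤
      partArboricity ε a := by
  have hk : (0 : ℝ) < numParts a := by exact_mod_cast one_le_numParts ha
  have hA : (⌊(2 + ε) * a⌋₊ : ℝ) ≤ (2 + ε) * a := Nat.floor_le (by positivity)
  have hM : 2 + ε ≤ (⌈2 + ε⌉₊ : ℝ) := Nat.le_ceil _
  have hM0 : (0 : ℝ) < (⌈2 + ε⌉₊ : ℝ) := by linarith
  refine Nat.le_floor ?_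
  rw [Nat.cast_add]
  have h1 : ((⌊(2 + ε) * a⌋₊ / numParts a : ℕ) : ℝ) ≤ (2 + ε) * (a / numParts a) := by
    refine Nat.cast_div_le.trans ?_
    rw [← mul_div_assoc]
    exact div_le_div_of_nonneg_right hA hk.le
  have h2 : ((⌊(2 + ε) * a⌋₊ / (⌈2 + ε⌉₊ * numParts a) : ℕ) : ℝ) ≤ a / numParts a := by
    refine Nat.cast_div_le.trans ?_
    rw [Nat.cast_mul, ← div_div]
    refine div_le_div_of_nonneg_right ?_ hk.le
    rw [div_le_iff₀ hM0, mul_comm (a : ℝ)]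
    exact hA.trans (mul_le_mul_of_nonneg_right hM (Nat.cast_nonneg a))
  calc _ ≤ (2 + ε) * (a / numParts a) + a / numParts a := add_le_add h1 h2
    _ = (3 + ε) * (a / numParts a) := by ring
    _ ≤ _ := mul_le_mul_of_nonneg_left (div_numParts_le ha) (by linarith)

theorem partArboricity_le {ε : ℝ} (hε : 0 < ε) (a : ℕ) :
    (partArboricity ε a : ℝ) ≤ (3 + ε) * (a : ℝ) ^ (2 / 3 : ℝ) :=
  Nat.floor_le (by positivity)

theorem one_le_partArboricity {ε : ℝ} (hε : 0 < ε) {a : ℕ} (ha : 1 ≤ a) : 1 ≤ partArboricity ε a := by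
  have h := one_le_rpow_of_one_le ha (z := 2 / 3) (by norm_num)
  refine Nat.le_floor ?_
  rw [Nat.cast_one]
  nlinarith

theorem legal_palette_le {ε : ℝ} (hε : 0 < ε) (a : ℕ) :
    ⌊(2 + ε) * partArboricity ε a⌋₊ + 1 ≤ paletteSize ε a := by
  refine Nat.add_le_add_right (Nat.floor_le_floor ?_) 1
  rw [mul_assoc]
  exact mul_le_mul_of_nonneg_left (partArboricity_le hε a) (by linarith)

theorem numParts_mul_paletteSize_le {ε : ℝ} (hε : 0 < ε) {a : ℕ} (ha : 1 ≤ a) :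
    numParts a * paletteSize ε a ≤ 2 * ((⌈ε⌉₊ + 3) ^ 2 + 1) * a := by
  have hy := one_le_rpow_of_one_le ha (z := 2 / 3) (by norm_num)
  have he : ε ≤ ⌈ε⌉₊ := Nat.le_ceil ε
  have h1 : (paletteSize ε a : ℝ) ≤ ((⌈ε⌉₊ + 3) ^ 2 + 1) * (a : ℝ) ^ (2 / 3 : ℝ) := by
    have h2 : (⌊(2 + ε) * (3 + ε) * (a : ℝ) ^ (2 / 3 : ℝ)⌋₊ : ℝ) ≤
        (2 + ε) * (3 + ε) * (a : ℝ) ^ (2 / 3 : ℝ) := Nat.floor_le (by positivity)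
    have h3 : (2 + ε) * (3 + ε) * (a : ℝ) ^ (2 / 3 : ℝ) ≤
        (⌈ε⌉₊ + 3) ^ 2 * (a : ℝ) ^ (2 / 3 : ℝ) :=
      mul_le_mul_of_nonneg_right (by nlinarith) (by linarith)
    rw [paletteSize, Nat.cast_add, Nat.cast_one]
    linarith
  have h4 : ((numParts a * paletteSize ε a : ℕ) : ℝ) ≤
      ((2 * ((⌈ε⌉₊ + 3) ^ 2 + 1) * a : ℕ) : ℝ) := by
    push_cast
    calc (numParts a : ℝ) * paletteSize ε a
        ≤ (2 * (a : ℝ) ^ (1 / 3 : ℝ)) * (((⌈ε⌉₊ + 3) ^ 2 + 1) * (a : ℝ) ^ (2 / 3 : ℝ)) :=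
          mul_le_mul (numParts_le ha) h1 (Nat.cast_nonneg _) (by positivity)
      _ = 2 * ((⌈ε⌉₊ + 3) ^ 2 + 1) * ((a : ℝ) ^ (1 / 3 : ℝ) * (a : ℝ) ^ (2 / 3 : ℝ)) := by ring
      _ = _ := by rw [cube_root_mul]
  exact_mod_cast h4

/-! ### Assembly of the coloring algorithm -/

/-- Legal colorings of the parts with disjoint palettes form a legal coloring. -/
theorem isLegalColoring_of_parts {V : Type u} [Fintype V] {G : SimpleGraph V} {ident : V → ℕ}
    {P : LocalAlg Unit ℕ} {χ : V → ℕ} {k γ g C : ℕ} (hχ : ∀ v, 1 ≤ χ v ∧ χ v ≤ k) (hg : g ≤ γ)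
    (hC : k * γ ≤ C)
    (hP : ∀ i, IsLegalColoring (G.induce {v | χ v = i}) g
      (P.run (G.induce {v | χ v = i}) (fun v => ident v) fun _ => ())) :
    IsLegalColoring G C fun v => ((P.onParts.run G ident χ v).1 - 1) * γ +
      (P.onParts.run G ident χ v).2 := by
  classical
  have h1 : ∀ v, (P.onParts.run G ident χ v).1 = χ v := fun v => by
    rw [LocalAlg.run_onParts G ident P χ (χ v) ⟨v, rfl⟩]
  have h2 : ∀ v, 1 ≤ (P.onParts.run G ident χ v).2 ∧ (P.onParts.run G ident χ v).2 ≤ γ := by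
    intro v
    rw [LocalAlg.run_onParts G ident P χ (χ v) ⟨v, rfl⟩]
    exact ⟨((hP _).1 _).1, ((hP _).1 _).2.trans hg⟩
  have hup : ∀ v, (χ v - 1) * γ + (P.onParts.run G ident χ v).2 ≤ χ v * γ := by
    intro v
    have h3 := (h2 v).2
    obtain ⟨i, hi⟩ : ∃ i, χ v = i + 1 := ⟨χ v - 1, by have := (hχ v).1; omega⟩
    rw [hi, Nat.add_sub_cancel, Nat.succ_mul]
    omega
  -- Part i uses colors in the interval ((i-1)γ, iγ], and these intervals are disjoint and ordered.
  have hlt : ∀ v w, χ v < χ w → (χ v - 1) * γ + (P.onParts.run G ident χ v).2 <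
      (χ w - 1) * γ + (P.onParts.run G ident χ w).2 := by
    intro v w h
    have h3 := Nat.mul_le_mul_right γ (show χ v ≤ χ w - 1 by omega)
    have h4 := hup v
    have h5 := (h2 w).1
    omega
  simp only [h1]
  refine ⟨fun v => ⟨?_, ?_⟩, fun v w ha e => ?_⟩
  · exact (h2 v).1.trans (Nat.le_add_left _ _)
  · exact (hup v).trans ((Nat.mul_le_mul_right γ (hχ v).2).trans hC)
  · dsimp only at e
    rcases lt_trichotomy (χ v) (χ w) with h | h | h
    · exact (hlt v w h).ne e
    · rw [h, Nat.add_left_cancel_iff, LocalAlg.run_onParts G ident P χ (χ w) ⟨v, h⟩,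
        LocalAlg.run_onParts G ident P χ (χ w) ⟨w, rfl⟩] at e
      exact (hP (χ w)).2 ⟨v, h⟩ ⟨w, rfl⟩ ha e
    · exact (hlt w v h).ne' e

/-- The first two parts say that subroutines as required exist; the last one analyses
the coloring algorithm for an arbitrary choice of the subroutines. The numbers `r` and `s` are
the durations of the `H`-partition step and of Procedure Simple-Arbdefective; they depend on `n` and `a`
only, and not on the graph. -/
theorem mainTheorem12 (ε : ℝ) (hε : 0 < ε) :
    (∃ D : ℕ → ℕ → ℕ → LocalAlg Unit ℕ, IsDefectiveColoringProcedure.{u} D) ∧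
    (∃ L : ℕ → ℕ → LocalAlg Unit ℕ, IsLegalColoringProcedure.{u} ε L) ∧
    ∀ (D : ℕ → ℕ → ℕ → LocalAlg Unit ℕ) (L : ℕ → ℕ → LocalAlg Unit ℕ),
      IsDefectiveColoringProcedure.{u} D → IsLegalColoringProcedure.{u} ε L →
      ∃ C : ℕ, ∀ n a : ℕ, 2 ≤ n → 1 ≤ a → ∃ r s : ℕ,
        ((firstColoring ε D L n a r s).rounds : ℝ)
          ≤ C * ((a : ℝ) ^ (2 / 3 : ℝ) * Real.logb 2 n) ∧
        ∀ (V : Type u) [Fintype V] (G : SimpleGraph V) (ident : V → ℕ),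
          Fintype.card V = n → IsIdentification n ident → ArboricityAtMost G a →
          (∀ v, 1 ≤ (hPartition ⌊(2 + ε) * a⌋₊ r).run G ident (fun _ => ()) v) ∧
          IsArbdefectiveColoring G (partArboricity ε a) (numParts a)
            ((partitionStep ε D n a r s).run G ident fun _ => ()) ∧
          IsLegalColoring G (C * a) ((firstColoring ε D L n a r s).run G ident fun _ => ()) := by
  refine ⟨exists_isDefectiveColoringProcedure, exists_isLegalColoringProcedure ε hε, ?_⟩
  rintro D L ⟨cD, hD⟩ ⟨cL, hL⟩
  obtain ⟨c₁, hc₁⟩ := exists_hPartition_rounds.{u} ε hε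
  set M := ⌈2 + ε⌉₊ with hMdef
  have hM : 1 ≤ M := Nat.one_le_iff_ne_zero.2 (Nat.ceil_pos.2 (by linarith)).ne'
  -- One constant serves both bounds: the last summand is for the number of colors, the others are
  -- for the running time.
  refine ⟨2 * c₁ + cD + 1 + (2 * c₁ + 1) * (4 * cD * M ^ 2) + cL * (⌈ε⌉₊ + 3) +
    2 * ((⌈ε⌉₊ + 3) ^ 2 + 1), fun n a hn ha => ?_⟩
  have hk := one_le_numParts ha
  have hb := one_le_partArboricity hε ha
  set r := c₁ * (Nat.log 2 n + 1) with hrdef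
  set K := cD * (M * numParts a) ^ 2 with hKdef
  obtain ⟨hDr, hDs⟩ := hD n ⌊(2 + ε) * a⌋₊ (M * numParts a) hn (Nat.mul_pos hM hk)
  obtain ⟨hLr, hLs⟩ := hL n (partArboricity ε a) hn hb
  -- Labels lie in [1, r] × [1, K], so (r+1)K rounds suffice for the selection; K = O(a^{2/3}) and r
  -- = O(log n).
  refine ⟨r, (r + 1) * K, ?_, ?_⟩
  · change ((r + ((D n ⌊(2 + ε) * a⌋₊ (M * numParts a)).rounds + 1) + (r + 1) * K +
      (L n (partArboricity ε a)).rounds : ℕ) : ℝ) ≤ _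
    have hl := one_le_logb_two hn
    have hl2 := log_add_one_le_two_mul_logb hn
    have hy := one_le_rpow_of_one_le ha (z := 2 / 3) (by norm_num)
    have hksq := numParts_sq_le ha
    have hbl := partArboricity_le hε a
    set ℓ := Real.logb 2 n
    set y := (a : ℝ) ^ (2 / 3 : ℝ)
    have hr : (r : ℝ) ≤ c₁ * (2 * ℓ) := by
      rw [hrdef, Nat.cast_mul]
      exact mul_le_mul_of_nonneg_left hl2 (Nat.cast_nonneg _)
    have hK : (K : ℝ) ≤ 4 * cD * M ^ 2 * y := by
      rw [hKdef]
      push_cast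
      calc (cD * (M * numParts a) ^ 2 : ℝ) = cD * M ^ 2 * (numParts a : ℝ) ^ 2 := by ring
        _ ≤ cD * M ^ 2 * (4 * y) := mul_le_mul_of_nonneg_left hksq (by positivity)
        _ = _ := by ring
    have hb' : (partArboricity ε a : ℝ) ≤ (⌈ε⌉₊ + 3) * y := by
      refine hbl.trans (mul_le_mul_of_nonneg_right ?_ (by linarith))
      have := Nat.le_ceil ε
      linarith
    have hℓ : ℓ ≤ y * ℓ := le_mul_of_one_le_left (by linarith) hy
    push_cast
    calc (r + ((D n ⌊(2 + ε) * a⌋₊ (M * numParts a)).rounds + 1) + (r + 1) * K +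
          (L n (partArboricity ε a)).rounds : ℝ)
        ≤ c₁ * (2 * ℓ) + (cD * ℓ + ℓ) + (c₁ * (2 * ℓ) + ℓ) * (4 * cD * M ^ 2 * y) +
          cL * ((⌈ε⌉₊ + 3) * y * ℓ) := by
          have : (L n (partArboricity ε a)).rounds ≤ cL * ((⌈ε⌉₊ + 3) * y * ℓ) :=
            hLr.trans (by gcongr)
          gcongr
      _ = (2 * c₁ + cD + 1) * ℓ + (2 * c₁ + 1) * (4 * cD * M ^ 2) * (y * ℓ) +
          cL * (⌈ε⌉₊ + 3) * (y * ℓ) := by ring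
      _ ≤ (2 * c₁ + cD + 1) * (y * ℓ) + (2 * c₁ + 1) * (4 * cD * M ^ 2) * (y * ℓ) +
          cL * (⌈ε⌉₊ + 3) * (y * ℓ) + 2 * ((⌈ε⌉₊ + 3) ^ 2 + 1) * (y * ℓ) := by
          have : (0 : ℝ) ≤ 2 * ((⌈ε⌉₊ + 3) ^ 2 + 1) * (y * ℓ) := by positivity
          have h2 : (2 * c₁ + cD + 1) * ℓ ≤ (2 * c₁ + cD + 1) * (y * ℓ) :=
            mul_le_mul_of_nonneg_left hℓ (by positivity)
          linarith
      _ = _ := by ring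
  · intro V _ G ident hcard hid hG
    have hH := hc₁ n a ha V G ident hcard.le hG
    obtain ⟨l, hl, hrun⟩ := partialOrientation_spec (G := G) hDs hid hH
    have harb : IsArbdefectiveColoring G (partArboricity ε a) (numParts a)
        ((partitionStep ε D n a r ((r + 1) * K)).run G ident fun _ => ()) := by
      rw [partitionStep, arbdefectiveColoring, LocalAlg.run_seq, hrun]
      exact hl.isArbdefectiveColoring hid.1 hk le_rfl (arbdefect_le_partArboricity hε ha)
    refine ⟨fun v => by rw [hPartition_run]; exact hH v, harb, ?_⟩
    have hfun : (firstColoring ε D L n a r ((r + 1) * K)).run G ident (fun _ => ()) =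
        fun v => (((L n (partArboricity ε a)).onParts.run G ident
          ((partitionStep ε D n a r ((r + 1) * K)).run G ident fun _ => ()) v).1 - 1) *
            paletteSize ε a + ((L n (partArboricity ε a)).onParts.run G ident
          ((partitionStep ε D n a r ((r + 1) * K)).run G ident fun _ => ()) v).2 := by
      funext v
      rw [firstColoring, LocalAlg.run_mapOut, LocalAlg.run_seq]
    rw [hfun]
    classical
    refine isLegalColoring_of_parts harb.1 (legal_palette_le hε a)
      ((numParts_mul_paletteSize_le hε ha).trans (Nat.mul_le_mul_right a (Nat.le_add_left _ _)))
      fun i => hLs _ _ _ (hid.induce _) (harb.2 i)
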